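/- Alphabets are finite, logarithms are to base $2$, and $H(X|Y)=H(XY)-H(Y)$, $I(X{:}Y)=H(X)+H(Y)-H(XY)$. Let $P_{XYZE}$ be a joint distribution of $X$ (Alice), $Y$ (Bob), $Z$ (reference) and $E$ (eavesdropper) which is *private*, $P_{XYZE}=P_{XYZ}\otimes P_E$, and *bi-disjoint*: with $T=XY$, $P_{TZ}(t,z)=\sum_i p(i)\,P_{T|I=i}(t)\,P_{Z|I=i}(z)$ for a finite probability distribution $p$ and probability distributions $P_{T|I=i}$, $P_{Z|I=i}$ such that $P_{T|I=i}(t)P_{T|I=j}(t)=0$ and $P_{Z|I=i}(z)P_{Z|I=j}(z)=0$ for all $t,z$ and all $i\neq j$. Let $\overline\Psi$ be the distribution of a perfect key bit, $\overline\Psi(0,0)=\overline\Psi(1,1)=\frac12$. A *merging protocol* on $n$ copies, which uses $k$ and leaves $l$ key bits, starts from $P_{XYZE}^{\otimes n}\otimes\overline\Psi^{\otimes k}$ (key halves with Alice and Bob). Alice and Bob each draw private local randomness, independent of everything else, and exchange finitely many public messages, each a function of the sender's own data, the sender's randomness and the earlier messages. The reference and the eavesdropper are passive. At the end Alice outputs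 $\widehat U^l\in\{0,1\}^l$ and Bob outputs $\widehat X^n\widehat Y^n\widehat V^l$. The *error* is the $\ell^1$ distance between the resulting joint distribution of $\widehat X^n\widehat Y^nZ^nE^n$, $\widehat U^l\widehat V^l$ and the public transcript $C$, and $P_{XYZE}^{\otimes n}\otimes\overline\Psi^{\otimes l}\otimes P'_C$, where $P'_C$ is the actual distribution of $C$. A *merging scheme* is a sequence of merging protocols, one for each $n$, with $k_n$ and $l_n$ key bits, whose errors tend to $0$. Its *secret key rate* on $n$ copies is $\frac1n(k_n-l_n)$. **Theorem 1.** Let $R_0=I(X{:}Z)-I(X{:}Y)$. Then $R_0=H(X|Y)-H(X|Z)$, and the secret key rate $R_0$ is necessary and sufficient for distribution merging: 1. for every merging scheme and every $\delta>0$, $\frac1n(k_n-l_n)\ge R_0-\delta$ for all sufficiently large $n$; 2. for every real $R\ge R_0$ (in particular $R=R_0$) there is a merging scheme with $\frac1n(k_n-l_n)\to R$; 3. if $R_0\ge0$, there is a merging scheme with $l_n=0$ for all $n$ and $\frac1n k_n\to R_0$, so that $R_0$ is the minimum rate of secret key consumed; 4. if $R_0<0$, there is a merging scheme with $k_n=0$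 for all $n$ and $\frac1n l_n\to I(X{:}Y)-I(X{:}Z)$, so that merging succeeds and $I(X{:}Y)-I(X{:}Z)$ bits of secret key per copy are left at the end. -/

import Mathlib

open Filter Topology

/-! ### Finite probability distributions

A probability distribution on a finite type `α` is a function `p : α → ℝ` with
`p ∈ stdSimplex ℝ α` (nonnegative entries that add up to one). -/

open Classical in
/-- The law of `f` under the distribution `p` (marginals are the case of projections). -/
noncomputable def law {α β : Type} [Fintype α] (p : α → ℝ) (f : α → β) : β → ℝ :=
  fun b => ∑ a, if f a = b then p a else 0

/-- Shannon entropy (in bits) of the random variable `f` under the distribution `p`. -/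
noncomputable def entropy {α β : Type} [Fintype α] [Fintype β] (p : α → ℝ) (f : α → β) : ℝ :=
  -∑ b, law p f b * Real.logb 2 (law p f b)

/-- Conditional entropy `H(f|g) = H(fg) - H(g)`, in bits. -/
noncomputable def condEntropy {α β γ : Type} [Fintype α] [Fintype β] [Fintype γ]
    (p : α → ℝ) (f : α → β) (g : α → γ) : ℝ :=
  entropy p (fun a => (f a, g a)) - entropy p g

/-- Mutual information `I(f:g) = H(f) + H(g) - H(fg)`, in bits. -/
noncomputable def mutualInfo {α β γ : Type} [Fintype α] [Fintype β] [Fintype γ]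
    (p : α → ℝ) (f : α → β) (g : α → γ) : ℝ :=
  entropy p f + entropy p g - entropy p (fun a => (f a, g a))

/-- The `ℓ¹` distance of two distributions on a finite type. -/
def l1Dist {α : Type} [Fintype α] (p q : α → ℝ) : ℝ := ∑ a, |p a - q a|

/-! ### Private bi-disjoint distributions

The variables are `X` (Alice), `Y` (Bob), `Z` (reference) and `E` (eavesdropper); their joint
distribution is a function on `X × Y × Z × E`. -/

/-- The distribution `Q` of a pair `(t, z)` is bi-disjoint: it is a mixture
`∑ i, p i • (PT i ⊗ PZ i)` of product distributions such that the `PT i` have pairwise disjoint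
supports and the `PZ i` have pairwise disjoint supports. -/
def IsBiDisjoint {T Z : Type} [Fintype T] [Fintype Z] (Q : T × Z → ℝ) : Prop :=
  ∃ (m : ℕ) (p : Fin m → ℝ) (PT : Fin m → T → ℝ) (PZ : Fin m → Z → ℝ),
    p ∈ stdSimplex ℝ (Fin m) ∧
    (∀ i, PT i ∈ stdSimplex ℝ T) ∧
    (∀ i, PZ i ∈ stdSimplex ℝ Z) ∧
    (∀ t z, Q (t, z) = ∑ i, p i * PT i t * PZ i z) ∧
    (∀ i j, i ≠ j → ∀ t, PT i t * PT j t = 0) ∧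
    (∀ i j, i ≠ j → ∀ z, PZ i z * PZ j z = 0)

/-- The eavesdropper's variable is independent of the other three:
`P_XYZE = P_XYZ ⊗ P_E`. -/
def IsPrivate {X Y Z E : Type} [Fintype X] [Fintype Y] [Fintype Z] [Fintype E]
    (P : X × Y × Z × E → ℝ) : Prop :=
  ∀ x y z e, P (x, y, z, e) =
    law P (fun w => (w.1, w.2.1, w.2.2.1)) (x, y, z) * law P (fun w => w.2.2.2) e

/-- The marginal `P_TZ`, where `T = XY`. -/
noncomputable def lawTZ {X Y Z E : Type} [Fintype X] [Fintype Y] [Fintype Z] [Fintype E]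
    (P : X × Y × Z × E → ℝ) : (X × Y) × Z → ℝ :=
  law P (fun w => ((w.1, w.2.1), w.2.2.1))

/-- The probability of the sequences `x, y, z, e` under `n` independent copies of `P`. -/
def iidLaw {X Y Z E : Type} (P : X × Y × Z × E → ℝ) {n : ℕ}
    (x : Fin n → X) (y : Fin n → Y) (z : Fin n → Z) (e : Fin n → E) : ℝ :=
  ∏ i, P (x i, y i, z i, e i)

/-- One bit of perfect key: both parties hold the same uniformly distributed bit. -/
noncomputable def keyBit (u v : Bool) : ℝ := if u = v then 1 / 2 else 0

/-- `m` independent bits of perfect key. -/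
noncomputable def keyLaw {m : ℕ} (u v : Fin m → Bool) : ℝ := ∏ i, keyBit (u i) (v i)

/-! ### Local operations and public communication -/

/-- A protocol of local operations and public communication. Alice has input in `A` and output in
`A'`, Bob has input in `B` and output in `B'`. At the start each of the two draws local
randomness (`RA`, `RB`), which is kept private; it is independent of everything else. There follow
finitely many rounds. In each round Alice and Bob each broadcast one message, which depends on the
sender's input, the sender's local randomness and the messages of all earlier rounds (a party that
should keep silent in a round broadcasts a constant message). At the end each party computes the
output from the same data. All alphabets are finite. -/
structure LOPC (A B A' B' : Type) where
  (RA RB MA MB : Type)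
  [fintypeRA : Fintype RA]
  [fintypeRB : Fintype RB]
  [fintypeMA : Fintype MA]
  [fintypeMB : Fintype MB]
  lawA : RA → ℝ
  lawB : RB → ℝ
  lawA_mem : lawA ∈ stdSimplex ℝ RA
  lawB_mem : lawB ∈ stdSimplex ℝ RB
  rounds : ℕ
  sendA : A → RA → (i : ℕ) → (Fin i → MA × MB) → MA
  sendB : B → RB → (i : ℕ) → (Fin i → MA × MB) → MB
  outA : A → RA → (Fin rounds → MA × MB) → A'
  outB : B → RB → (Fin rounds → MA × MB) → B'

attribute [instance] LOPC.fintypeRA LOPC.fintypeRB LOPC.fintypeMA LOPC.fintypeMB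

namespace LOPC

variable {A B A' B' : Type}

/-- The possible public transcripts of a complete run. -/
abbrev Transcript (π : LOPC A B A' B') : Type := Fin π.rounds → π.MA × π.MB

/-- The messages of the first `i` rounds, for given inputs and local randomness. -/
def history (π : LOPC A B A' B') (a : A) (b : B) (ra : π.RA) (rb : π.RB) :
    (i : ℕ) → (Fin i → π.MA × π.MB)
  | 0 => Fin.elim0
  | i + 1 =>
      Fin.snoc (α := fun _ => π.MA × π.MB) (history π a b ra rb i)
        (π.sendA a ra i (history π a b ra rb i), π.sendB b rb i (history π a b ra rb i))

/-- The public transcript of a complete run. -/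
def transcript (π : LOPC A B A' B') (a : A) (b : B) (ra : π.RA) (rb : π.RB) : π.Transcript :=
  π.history a b ra rb π.rounds

open Classical in
/-- Joint distribution, at the end of the protocol, of Alice's output, Bob's output, the data `s`
of the parties that are passive, and the public transcript, if `Q` is the joint distribution of
Alice's input, Bob's input and `s` at the start. -/
noncomputable def apply [Fintype A] [Fintype B] {S : Type} (π : LOPC A B A' B')
    (Q : A → B → S → ℝ) (a' : A') (b' : B') (s : S) (c : π.Transcript) : ℝ :=
  ∑ a, ∑ b, ∑ ra, ∑ rb,
    if π.transcript a b ra rb = c ∧ π.outA a ra c = a' ∧ π.outB b rb c = b' then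
      Q a b s * π.lawA ra * π.lawB rb
    else 0

end LOPC

/-! ### Distribution merging -/

/-- A protocol on `n` copies that starts with `k` bits of key and ends with `l` bits of key.
Alice has `(x, u)`, where `u` is her copy of the initial key, and ends up with her copy of the
final key. Bob has `(y, v)` and ends up with `(x̂, ŷ, v̂)`. -/
abbrev MergingProtocol (X Y : Type) (n k l : ℕ) : Type 1 :=
  LOPC ((Fin n → X) × (Fin k → Bool)) ((Fin n → Y) × (Fin k → Bool))
    (Fin l → Bool) ((Fin n → X) × (Fin n → Y) × (Fin l → Bool))

namespace MergingProtocol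

variable {X Y Z E : Type} [Fintype X] [Fintype Y] [Fintype Z] [Fintype E] {n k l : ℕ}

/-- The situation at the end of the protocol: Alice's key, Bob's sequences and key, the sequences
of the reference and of the eavesdropper, and the public transcript. -/
abbrev Final (Z E : Type) (π : MergingProtocol X Y n k l) : Type :=
  (Fin l → Bool) × ((Fin n → X) × (Fin n → Y) × (Fin l → Bool)) ×
    ((Fin n → Z) × (Fin n → E)) × π.Transcript

/-- The actual distribution at the end, if the start is `P_XYZE^n ⊗ Ψ^k`. -/
noncomputable def actual (P : X × Y × Z × E → ℝ) (π : MergingProtocol X Y n k l) :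
    Final Z E π → ℝ := fun w =>
  π.apply (fun (a : (Fin n → X) × (Fin k → Bool)) (b : (Fin n → Y) × (Fin k → Bool))
      (s : (Fin n → Z) × (Fin n → E)) => iidLaw P a.1 b.1 s.1 s.2 * keyLaw a.2 b.2)
    w.1 w.2.1 w.2.2.1 w.2.2.2

/-- The ideal distribution at the end: `P_XYZE^n ⊗ Ψ^l`, with `x̂, ŷ` in the place of the source
sequences, and independent of the public transcript, which has its actual distribution. -/
noncomputable def ideal (P : X × Y × Z × E → ℝ) (π : MergingProtocol X Y n k l) :
    Final Z E π → ℝ := fun w =>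
  match w with
  | (u, (x, y, v), (z, e), c) =>
      iidLaw P x y z e * keyLaw u v * law (π.actual P) (fun w' => w'.2.2.2) c

/-- The error of the protocol: `ℓ¹` distance of the actual and the ideal final distribution. -/
noncomputable def error (P : X × Y × Z × E → ℝ) (π : MergingProtocol X Y n k l) : ℝ :=
  l1Dist (π.actual P) (π.ideal P)

end MergingProtocol

/-- Distribution merging for `P`: for each number `n` of copies a protocol, which uses `k n` bits
of key and leaves `l n` bits of key, such that the error tends to zero. -/
structure MergingScheme {X Y Z E : Type} [Fintype X] [Fintype Y] [Fintype Z] [Fintype E]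
    (P : X × Y × Z × E → ℝ) where
  k : ℕ → ℕ
  l : ℕ → ℕ
  protocol : (n : ℕ) → MergingProtocol X Y n (k n) (l n)
  error_tendsto : Tendsto (fun n => (protocol n).error P) atTop (𝓝 0)

/-- The secret key rate `(k - l) / n` on `n` copies. -/
noncomputable def MergingScheme.rate {X Y Z E : Type}
    [Fintype X] [Fintype Y] [Fintype Z] [Fintype E]
    {P : X × Y × Z × E → ℝ} (S : MergingScheme P) (n : ℕ) : ℝ :=
  ((S.k n : ℝ) - (S.l n : ℝ)) / (n : ℝ)

/-- `I(X:Y)` for the joint distribution `P` of `X, Y, Z, E`. -/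
noncomputable def infoXY {X Y Z E : Type} [Fintype X] [Fintype Y] [Fintype Z] [Fintype E]
    (P : X × Y × Z × E → ℝ) : ℝ :=
  mutualInfo P (fun w => w.1) (fun w => w.2.1)

/-- `I(X:Z)` for the joint distribution `P` of `X, Y, Z, E`. -/
noncomputable def infoXZ {X Y Z E : Type} [Fintype X] [Fintype Y] [Fintype Z] [Fintype E]
    (P : X × Y × Z × E → ℝ) : ℝ :=
  mutualInfo P (fun w => w.1) (fun w => w.2.2.1)

/-! ### Laws and entropies -/

/-! Both directions compare Bob with everybody else: Alice together with the passive parties.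

Converse. The information density between Bob and the rest is close to `n I(Y:XZE) + k` at the start
and close to `n I(XY:ZE) + l` in the target, and local operations with public communication cannot
raise it. The difference of the two informations is `H(X|Y) - H(X|ZE)`, which privacy turns into
`H(X|Y) - H(X|Z)`. In one-shot form (`LOPC.le_sum_abs_apply_sub`): the typical part of the start is
dominated by `K` times a product; a protocol turns a product into something that is a product for
each transcript (`LOPC.exists_apply_mul_eq`); a distribution with density at least `L` has overlap
of order at most `1/√L` with every product (`sum_sqrt_mul_mul_le`). If `K/L` is small, the error is
therefore close to 2. Chebyshev's inequality supplies `K` and `L` for `n` copies.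

Achievability. Alice hashes `x` at random to three strings: `F` of `a` bits is published, `G` of `k`
bits is published under a one-time pad, `K` of `l` bits becomes the new key. Bob can decode `x` from
`y`, `F`, `G` once `a + k` exceeds `n H(X|Y)`; the pair `(F, K)` is almost uniform and independent
of `ZE` once `a + l` is below `n H(X|ZE)`. A suitable `a` exists as soon as `k - l` exceeds `n R₀`
by a sublinear margin.

The decoded `x` is still correlated with `F` and `K`, so Bob does not output it but samples a new
pair. Bi-disjointness makes this possible: `(x, y)` and `z` each determine the index of the mixture,
and the index is all they share. So Bob can sample from the law of `XY` given `z` without knowing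
`z` (`IsBiDisjoint.exists_channel`). Given `z`, the new pair is independent of transcript and key,
and the error comes down to the decoding error and the distance of `(F, K)` from uniform
(`hashProtocol_error_le`, `exists_hash`). -/

theorem law_nonneg {α β : Type} [Fintype α] {p : α → ℝ} (hp : ∀ a, 0 ≤ p a) (f : α → β) (b : β) :
    0 ≤ law p f b :=
  Finset.sum_nonneg fun a _ => by split_ifs <;> simp [hp]

theorem sum_law_mul {α β : Type} [Fintype α] [Fintype β] (p : α → ℝ) (f : α → β) (φ : β → ℝ) :
    ∑ b, law p f b * φ b = ∑ a, p a * φ (f a) := by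
  classical
  simp only [law, Finset.sum_mul]
  rw [Finset.sum_comm]
  refine Finset.sum_congr rfl fun a _ => ?_
  simp [ite_mul]

theorem sum_law {α β : Type} [Fintype α] [Fintype β] (p : α → ℝ) (f : α → β) :
    ∑ b, law p f b = ∑ a, p a := by
  simpa using sum_law_mul p f fun _ => 1

theorem le_law_apply {α β : Type} [Fintype α] {p : α → ℝ} (hp : ∀ a, 0 ≤ p a) (f : α → β)
    (a : α) : p a ≤ law p f (f a) := by
  classical
  have h := Finset.single_le_sum (f := fun a' => if f a' = f a then p a' else 0)
    (fun a' _ => by split_ifs <;> simp [hp]) (Finset.mem_univ a)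
  simp only [if_true] at h
  unfold law
  convert h

theorem law_apply_pos {α β : Type} [Fintype α] {p : α → ℝ} (hp : ∀ a, 0 ≤ p a) (f : α → β)
    {a : α} (ha : p a ≠ 0) : 0 < law p f (f a) :=
  (lt_of_le_of_ne (hp a) ha.symm).trans_le (le_law_apply hp f a)

theorem entropy_eq {α β : Type} [Fintype α] [Fintype β] (p : α → ℝ) (f : α → β) :
    entropy p f = -∑ a, p a * Real.logb 2 (law p f (f a)) := by
  rw [entropy, sum_law_mul p f fun b => Real.logb 2 (law p f b)]

/-- Two random variables that agree outside of an event have laws that differ at most by twice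
the probability of the event. -/
theorem sum_abs_law_sub_law_le {α β : Type} [Fintype α] [Fintype β] {p : α → ℝ}
    (hp : ∀ a, 0 ≤ p a) (f g : α → β) (bad : α → Prop) [DecidablePred bad]
    (h : ∀ a, ¬ bad a → f a = g a) :
    ∑ b, |law p f b - law p g b| ≤ 2 * ∑ a, if bad a then p a else 0 := by
  classical
  calc ∑ b, |law p f b - law p g b|
      ≤ ∑ b, ∑ a, if bad a then
          ((if f a = b then p a else 0) + if g a = b then p a else 0) else 0 := by
        refine Finset.sum_le_sum fun b _ => ?_
        have : law p f b - law p g b =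
            ∑ a, ((if f a = b then p a else 0) - if g a = b then p a else 0) := by
          rw [Finset.sum_sub_distrib]; unfold law; congr!
        rw [this]
        refine (Finset.abs_sum_le_sum_abs _ _).trans (Finset.sum_le_sum fun a _ => ?_)
        by_cases ha : bad a
        · rw [if_pos ha]
          have := hp a
          split_ifs <;> simp [abs_of_nonneg, this]
        · rw [if_neg ha, h a ha]; simp
    _ = 2 * ∑ a, if bad a then p a else 0 := by
        rw [Finset.sum_comm, Finset.mul_sum]
        refine Finset.sum_congr rfl fun a _ => ?_
        split_ifs
        · rw [Finset.sum_add_distrib]; simp; ring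
        · simp

/-! ### Product distributions -/

section ProductLaw

variable {ι V : Type*} [Fintype ι] [DecidableEq ι] [Fintype V] {ρ : ι → V → ℝ}

theorem sum_prod_apply_eq (f : ι → V → ℝ) :
    ∑ Φ : ι → V, ∏ i, f i (Φ i) = ∏ i, ∑ v, f i v := by
  rw [Finset.prod_univ_sum, Fintype.piFinset_univ]

theorem sum_prod_mul_apply (hρ : ∀ i, ∑ v, ρ i v = 1) (i₀ : ι) (h : V → ℝ) :
    ∑ Φ : ι → V, (∏ i, ρ i (Φ i)) * h (Φ i₀) = ∑ v, ρ i₀ v * h v := by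
  have : ∀ Φ : ι → V, (∏ i, ρ i (Φ i)) * h (Φ i₀) =
      ∏ i, (ρ i (Φ i) * if i = i₀ then h (Φ i) else 1) := fun Φ => by
    rw [Finset.prod_mul_distrib, Finset.prod_ite_eq' Finset.univ i₀]; simp
  simp only [this]
  rw [sum_prod_apply_eq (fun i v => ρ i v * if i = i₀ then h v else 1),
    Finset.prod_eq_single i₀]
  · simp
  · intro i _ hi; simp [hi, hρ]
  · simp

theorem sum_prod_mul_apply_mul_apply (hρ : ∀ i, ∑ v, ρ i v = 1) {i₀ i₁ : ι} (hi : i₀ ≠ i₁)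
    (h h' : V → ℝ) :
    ∑ Φ : ι → V, (∏ i, ρ i (Φ i)) * (h (Φ i₀) * h' (Φ i₁)) =
      (∑ v, ρ i₀ v * h v) * ∑ v, ρ i₁ v * h' v := by
  have : ∀ Φ : ι → V, (∏ i, ρ i (Φ i)) * (h (Φ i₀) * h' (Φ i₁)) =
      ∏ i, (ρ i (Φ i) * ((if i = i₀ then h (Φ i) else 1) * if i = i₁ then h' (Φ i) else 1)) :=
    fun Φ => by
      rw [Finset.prod_mul_distrib, Finset.prod_mul_distrib,
        Finset.prod_ite_eq' Finset.univ i₀, Finset.prod_ite_eq' Finset.univ i₁]; simp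
  simp only [this]
  rw [sum_prod_apply_eq
      (fun i v => ρ i v * ((if i = i₀ then h v else 1) * if i = i₁ then h' v else 1)),
    Finset.prod_eq_mul i₀ i₁ hi]
  · simp [hi, hi.symm]
  · intro i _ h2; simp [h2.1, h2.2, hρ]
  · simp
  · simp

/-- The cross terms vanish by independence and zero mean. Both Chebyshev's inequality and the
leftover hash bound rest on this. -/
theorem sum_prod_mul_sq_sum (hρ : ∀ i, ∑ v, ρ i v = 1) (h : ι → V → ℝ)
    (h0 : ∀ i, ∑ v, ρ i v * h i v = 0) :
    ∑ Φ : ι → V, (∏ i, ρ i (Φ i)) * (∑ i, h i (Φ i)) ^ 2 = ∑ i, ∑ v, ρ i v * h i v ^ 2 := by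
  have e : ∀ Φ : ι → V, (∏ i, ρ i (Φ i)) * (∑ i, h i (Φ i)) ^ 2 =
      ∑ j, ∑ j', (∏ i, ρ i (Φ i)) * (h j (Φ j) * h j' (Φ j')) := fun Φ => by
    rw [sq, Finset.sum_mul_sum, Finset.mul_sum]
    simp only [Finset.mul_sum]
  simp only [e]
  rw [Finset.sum_comm]
  refine Finset.sum_congr rfl fun j _ => ?_
  rw [Finset.sum_comm, Finset.sum_eq_single j]
  · simp only [← sq]
    exact sum_prod_mul_apply hρ j fun v => h j v ^ 2
  · intro j' _ hj
    rw [sum_prod_mul_apply_mul_apply hρ hj.symm, h0, zero_mul]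
  · simp

end ProductLaw

/-- Chebyshev's inequality for independent copies. -/
theorem sum_prod_ite_le_of_iid {Ω : Type*} [Fintype Ω] {p : Ω → ℝ} (hp : p ∈ stdSimplex ℝ Ω)
    (g : Ω → ℝ) (n : ℕ) {t : ℝ} (ht : 0 < t) :
    (∑ w : Fin n → Ω, if t ≤ |∑ i, g (w i) - n * ∑ a, p a * g a| then ∏ i, p (w i) else 0) ≤
      n * (∑ a, p a * (g a - ∑ b, p b * g b) ^ 2) / t ^ 2 := by
  set m := ∑ b, p b * g b with hm
  have key := sum_prod_mul_sq_sum (ι := Fin n) (ρ := fun _ => p) (fun _ => hp.2)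
    (fun _ a => g a - m) (fun _ => by
      simp only [mul_sub, Finset.sum_sub_distrib, ← Finset.sum_mul, hp.2, one_mul, hm, sub_self])
  rw [le_div_iff₀ (by positivity), Finset.sum_mul]
  calc _ ≤ ∑ w : Fin n → Ω, (∏ i, p (w i)) * (∑ i, (g (w i) - m)) ^ 2 := by
        refine Finset.sum_le_sum fun w _ => ?_
        have hw : 0 ≤ ∏ i, p (w i) := Finset.prod_nonneg fun i _ => hp.1 _
        split_ifs with h
        · refine mul_le_mul_of_nonneg_left ?_ hw
          rw [Finset.sum_sub_distrib]
          simp only [Finset.sum_const, Finset.card_univ, Fintype.card_fin, nsmul_eq_mul]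
          rw [← sq_abs (_ - _)]
          exact pow_le_pow_left₀ ht.le h 2
        · rw [zero_mul]; positivity
    _ = _ := by rw [key]; simp

/-! ### Transcripts, linearity, and protocols on product inputs -/

namespace LOPC

variable {A B A' B' S : Type}

/-- The inputs and coins that produce a given transcript form a rectangle: a condition on Alice's
data alone and one on Bob's alone. Product structure survives communication for this reason. -/
theorem history_eq_iff (π : LOPC A B A' B') (a : A) (b : B) (ra : π.RA) (rb : π.RB) {N : ℕ}
    (c : Fin N → π.MA × π.MB) :
    π.history a b ra rb N = c ↔
      (∀ i : Fin N, π.sendA a ra i (fun j => c (j.castLE i.2.le)) = (c i).1) ∧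
      (∀ i : Fin N, π.sendB b rb i (fun j => c (j.castLE i.2.le)) = (c i).2) := by
  induction N with
  | zero =>
    exact ⟨fun _ => ⟨fun i => i.elim0, fun i => i.elim0⟩, fun _ => funext fun i => i.elim0⟩
  | succ N ih =>
    have h1 : π.history a b ra rb (N + 1) = c ↔ π.history a b ra rb N = Fin.init c ∧
        (π.sendA a ra N (π.history a b ra rb N), π.sendB b rb N (π.history a b ra rb N)) =
          c (Fin.last N) := by
      rw [history]
      constructor
      · intro h
        subst h
        simp
      · rintro ⟨h, h'⟩
        rw [h', h]
        exact Fin.snoc_init_self c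
    rw [h1, ih, Fin.forall_fin_succ', Fin.forall_fin_succ', Prod.ext_iff]
    have h2 : ∀ i : Fin N, (fun j : Fin i => Fin.init c (j.castLE i.2.le)) =
        fun j : Fin i.castSucc => c (j.castLE i.castSucc.2.le) := fun i => rfl
    have h3 : (fun j : Fin (Fin.last N) => c (j.castLE (Fin.last N).2.le)) = Fin.init c := rfl
    constructor
    · rintro ⟨⟨ha, hb⟩, ha', hb'⟩
      have hh := (ih (Fin.init c)).2 ⟨ha, hb⟩
      rw [hh] at ha' hb'
      exact ⟨⟨ha, ha'⟩, ⟨hb, hb'⟩⟩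
    · rintro ⟨⟨ha, ha'⟩, ⟨hb, hb'⟩⟩
      have hh := (ih (Fin.init c)).2 ⟨ha, hb⟩
      rw [hh]
      exact ⟨⟨ha, hb⟩, ha', hb'⟩

variable [Fintype A] [Fintype B]

theorem apply_nonneg (π : LOPC A B A' B') {Q : A → B → S → ℝ} (hQ : ∀ a b s, 0 ≤ Q a b s)
    (a' : A') (b' : B') (s : S) (c : π.Transcript) : 0 ≤ π.apply Q a' b' s c := by
  unfold apply
  refine Finset.sum_nonneg fun a _ => Finset.sum_nonneg fun b _ => Finset.sum_nonneg fun ra _ =>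
    Finset.sum_nonneg fun rb _ => ?_
  split_ifs
  · exact mul_nonneg (mul_nonneg (hQ a b s) (π.lawA_mem.1 ra)) (π.lawB_mem.1 rb)
  · rfl

theorem apply_mono (π : LOPC A B A' B') {Q Q' : A → B → S → ℝ} (h : ∀ a b s, Q a b s ≤ Q' a b s)
    (a' : A') (b' : B') (s : S) (c : π.Transcript) :
    π.apply Q a' b' s c ≤ π.apply Q' a' b' s c := by
  unfold apply
  refine Finset.sum_le_sum fun a _ => Finset.sum_le_sum fun b _ => Finset.sum_le_sum fun ra _ =>
    Finset.sum_le_sum fun rb _ => ?_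
  split_ifs
  · exact mul_le_mul_of_nonneg_right
      (mul_le_mul_of_nonneg_right (h a b s) (π.lawA_mem.1 ra)) (π.lawB_mem.1 rb)
  · rfl

theorem apply_add (π : LOPC A B A' B') (Q Q' : A → B → S → ℝ)
    (a' : A') (b' : B') (s : S) (c : π.Transcript) :
    π.apply (fun a b s => Q a b s + Q' a b s) a' b' s c =
      π.apply Q a' b' s c + π.apply Q' a' b' s c := by
  unfold apply
  simp only [← Finset.sum_add_distrib]
  refine Finset.sum_congr rfl fun a _ => Finset.sum_congr rfl fun b _ =>
    Finset.sum_congr rfl fun ra _ => Finset.sum_congr rfl fun rb _ => ?_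
  split_ifs <;> ring

theorem apply_const_mul (π : LOPC A B A' B') (K : ℝ) (Q : A → B → S → ℝ)
    (a' : A') (b' : B') (s : S) (c : π.Transcript) :
    π.apply (fun a b s => K * Q a b s) a' b' s c = K * π.apply Q a' b' s c := by
  unfold apply
  simp only [Finset.mul_sum]
  refine Finset.sum_congr rfl fun a _ => Finset.sum_congr rfl fun b _ =>
    Finset.sum_congr rfl fun ra _ => Finset.sum_congr rfl fun rb _ => ?_
  split_ifs <;> ring

/-- The final distribution of a protocol as the law of the final data on the probability space of
inputs and local randomness. -/
theorem apply_eq_law [Fintype S] (π : LOPC A B A' B') (Q : A → B → S → ℝ) :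
    (fun w : A' × B' × S × π.Transcript => π.apply Q w.1 w.2.1 w.2.2.1 w.2.2.2) =
      law (fun ω : (A × B) × S × π.RA × π.RB =>
          Q ω.1.1 ω.1.2 ω.2.1 * π.lawA ω.2.2.1 * π.lawB ω.2.2.2)
        (fun ω => (π.outA ω.1.1 ω.2.2.1 (π.transcript ω.1.1 ω.1.2 ω.2.2.1 ω.2.2.2),
          π.outB ω.1.2 ω.2.2.2 (π.transcript ω.1.1 ω.1.2 ω.2.2.1 ω.2.2.2), ω.2.1,
          π.transcript ω.1.1 ω.1.2 ω.2.2.1 ω.2.2.2)) := by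
  classical
  funext ⟨a', b', s, c⟩
  simp only [apply, law, Fintype.sum_prod_type]
  refine Finset.sum_congr rfl fun a _ => Finset.sum_congr rfl fun b _ => ?_
  rw [Finset.sum_eq_single s]
  · refine Finset.sum_congr rfl fun ra _ => Finset.sum_congr rfl fun rb _ => ?_
    refine if_congr ?_ rfl rfl
    simp only [Prod.mk.injEq]
    constructor
    · rintro ⟨rfl, h1, h2⟩; exact ⟨h1, h2, trivial, rfl⟩
    · rintro ⟨h1, h2, -, rfl⟩; exact ⟨rfl, h1, h2⟩
  · intro s' _ hs
    refine Finset.sum_eq_zero fun ra _ => Finset.sum_eq_zero fun rb _ => if_neg ?_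
    simp [hs]
  · simp

theorem sum_apply [Fintype A'] [Fintype B'] [Fintype S] (π : LOPC A B A' B')
    (Q : A → B → S → ℝ) :
    ∑ w : A' × B' × S × π.Transcript, π.apply Q w.1 w.2.1 w.2.2.1 w.2.2.2 =
      ∑ a, ∑ b, ∑ s, Q a b s := by
  have := congrArg (fun f => ∑ w, f w) (π.apply_eq_law Q)
  simp only [sum_law] at this
  rw [this]
  simp only [Fintype.sum_prod_type, ← Finset.mul_sum, π.lawA_mem.2, π.lawB_mem.2, mul_one]

/-- If the inputs of Alice and Bob are independent, their outputs are independent, given the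
public transcript. -/
theorem exists_apply_mul_eq (π : LOPC A B A' B') {p : A → S → ℝ} {q : B → ℝ}
    (hp : ∀ a s, 0 ≤ p a s) (hq : ∀ b, 0 ≤ q b) :
    ∃ (μ : π.Transcript → A' → S → ℝ) (ν : π.Transcript → B' → ℝ),
      (∀ c a' s, 0 ≤ μ c a' s) ∧ (∀ c b', 0 ≤ ν c b') ∧
      ∀ a' b' s c, π.apply (fun a b s => p a s * q b) a' b' s c = μ c a' s * ν c b' := by
  classical
  -- Each factor collects the weight of one party's inputs and coins that are consistent with the
  -- transcript `c` and give the stated output.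
  refine ⟨fun c a' s => ∑ a, ∑ ra,
      if (∀ i : Fin π.rounds, π.sendA a ra i (fun j => c (j.castLE i.2.le)) = (c i).1) ∧
        π.outA a ra c = a' then p a s * π.lawA ra else 0,
    fun c b' => ∑ b, ∑ rb,
      if (∀ i : Fin π.rounds, π.sendB b rb i (fun j => c (j.castLE i.2.le)) = (c i).2) ∧
        π.outB b rb c = b' then q b * π.lawB rb else 0, ?_, ?_, ?_⟩
  · refine fun c a' s => Finset.sum_nonneg fun a _ => Finset.sum_nonneg fun ra _ => ?_
    split_ifs
    · exact mul_nonneg (hp a s) (π.lawA_mem.1 ra)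
    · rfl
  · refine fun c b' => Finset.sum_nonneg fun b _ => Finset.sum_nonneg fun rb _ => ?_
    split_ifs
    · exact mul_nonneg (hq b) (π.lawB_mem.1 rb)
    · rfl
  · intro a' b' s c
    simp only [apply, Finset.sum_mul_sum]
    refine Finset.sum_congr rfl fun a _ => Finset.sum_congr rfl fun b _ =>
      Finset.sum_congr rfl fun ra _ => Finset.sum_congr rfl fun rb _ => ?_
    simp only [transcript, history_eq_iff]
    by_cases h1 : ∀ i : Fin π.rounds, π.sendA a ra i (fun j => c (j.castLE i.2.le)) = (c i).1 <;>
    by_cases h2 : ∀ i : Fin π.rounds, π.sendB b rb i (fun j => c (j.castLE i.2.le)) = (c i).2 <;>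
    by_cases h3 : π.outA a ra c = a' <;> by_cases h4 : π.outB b rb c = b' <;>
    simp [h1, h2, h3, h4]
    ring

end LOPC

/-! ### The one-shot converse -/

/-- A distribution `D` with large information density has small overlap with every product. -/
theorem sum_sqrt_mul_mul_le {A S B : Type} [Fintype A] [Fintype S] [Fintype B]
    {μ : A → S → ℝ} {ν : B → ℝ} (hμ : ∀ a s, 0 ≤ μ a s) (hν : ∀ b, 0 ≤ ν b)
    {D : A → B → S → ℝ} (hD : ∀ a b s, 0 ≤ D a b s)
    {qA : A → S → ℝ} {qB : B → ℝ} (hqA : ∀ a s, ∑ b, D a b s ≤ qA a s)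
    (hqB : ∀ b, ∑ a, ∑ s, D a b s ≤ qB b) {L : ℝ} (hL : 0 < L)
    (good : A → B → S → Prop) [∀ a b s, Decidable (good a b s)]
    (h : ∀ a b s, good a b s → D a b s ≠ 0 → L * (qA a s * qB b) ≤ D a b s) :
    (∑ a, ∑ b, ∑ s, if good a b s then √(μ a s * ν b * D a b s) else 0) ≤
      √((∑ a, ∑ s, μ a s) * (∑ b, ν b) / L) := by
  classical
  have hA0 : ∀ a s, 0 ≤ qA a s := fun a s =>
    (Finset.sum_nonneg fun b _ => hD a b s).trans (hqA a s)
  have hB0 : ∀ b, 0 ≤ qB b := fun b =>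
    (Finset.sum_nonneg fun a _ => Finset.sum_nonneg fun s _ => hD a b s).trans (hqB b)
  have hDA : ∀ a b s, D a b s ≤ qA a s := fun a b s =>
    (Finset.single_le_sum (fun b _ => hD a b s) (Finset.mem_univ b)).trans (hqA a s)
  have hDB : ∀ a b s, D a b s ≤ qB b := fun a b s =>
    ((Finset.single_le_sum (f := fun s => D a b s) (fun s _ => hD a b s)
      (Finset.mem_univ s)).trans (Finset.single_le_sum (f := fun a => ∑ s, D a b s)
      (fun a _ => Finset.sum_nonneg fun s _ => hD a b s) (Finset.mem_univ a))).trans (hqB b)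
  -- Cauchy-Schwarz is applied to `f` and `g`. The quotients by `qA` and `qB` act as conditional
  -- distributions, so the total masses are at most those of `μ` and of `ν / L`.
  let f : A × B × S → ℝ := fun w => μ w.1 w.2.2 * (D w.1 w.2.1 w.2.2 / qA w.1 w.2.2)
  let g : A × B × S → ℝ := fun w => ν w.2.1 * (D w.1 w.2.1 w.2.2 / (L * qB w.2.1))
  have hf : ∀ w, 0 ≤ f w := fun w => mul_nonneg (hμ _ _) (div_nonneg (hD _ _ _) (hA0 _ _))
  have hg : ∀ w, 0 ≤ g w := fun w =>
    mul_nonneg (hν _) (div_nonneg (hD _ _ _) (mul_nonneg hL.le (hB0 _)))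
  have hfs : ∑ w, f w ≤ ∑ a, ∑ s, μ a s := by
    simp only [Fintype.sum_prod_type, f]
    refine Finset.sum_le_sum fun a _ => ?_
    rw [Finset.sum_comm]
    refine Finset.sum_le_sum fun s _ => ?_
    rw [← Finset.mul_sum, ← Finset.sum_div]
    exact mul_le_of_le_one_right (hμ a s) (div_le_one_of_le₀ (hqA a s) (hA0 a s))
  have hgs : ∑ w, g w ≤ (∑ b, ν b) / L := by
    simp only [Fintype.sum_prod_type, g]
    rw [Finset.sum_comm, Finset.sum_div]
    refine Finset.sum_le_sum fun b _ => ?_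
    simp only [← Finset.mul_sum, ← Finset.sum_div]
    rw [mul_comm L, ← div_div, div_eq_mul_inv (ν b), ← mul_div_assoc, div_eq_mul_inv _ L]
    refine mul_le_mul_of_nonneg_right ?_ (inv_nonneg.2 hL.le)
    exact mul_le_of_le_one_right (hν b) (div_le_one_of_le₀ (hqB b) (hB0 b))
  calc (∑ a, ∑ b, ∑ s, if good a b s then √(μ a s * ν b * D a b s) else 0)
      = ∑ w : A × B × S, if good w.1 w.2.1 w.2.2 then
          √(μ w.1 w.2.2 * ν w.2.1 * D w.1 w.2.1 w.2.2) else 0 := by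
        simp only [Fintype.sum_prod_type]
    _ ≤ ∑ w, √(f w) * √(g w) := by
        refine Finset.sum_le_sum fun w _ => ?_
        split_ifs with hw
        · rw [← Real.sqrt_mul (hf w)]
          refine Real.sqrt_le_sqrt ?_
          by_cases h0 : D w.1 w.2.1 w.2.2 = 0
          · rw [h0, mul_zero]; exact mul_nonneg (hf w) (hg w)
          · have hpos := lt_of_le_of_ne (hD w.1 w.2.1 w.2.2) (Ne.symm h0)
            have h1 := hpos.trans_le (hDA w.1 w.2.1 w.2.2)
            have h2 := hpos.trans_le (hDB w.1 w.2.1 w.2.2)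
            have h3 := h _ _ _ hw h0
            -- Where `L qA qB ≤ D`, the factor `D / (L qA qB)` is at least one.
            have h4 : D w.1 w.2.1 w.2.2 ≤ (D w.1 w.2.1 w.2.2 / qA w.1 w.2.2) *
                (D w.1 w.2.1 w.2.2 / (L * qB w.2.1)) := by
              rw [div_mul_div_comm, le_div_iff₀ (by positivity)]
              refine mul_le_mul_of_nonneg_left (le_of_eq_of_le ?_ h3) hpos.le
              ring
            calc _ ≤ μ w.1 w.2.2 * ν w.2.1 * _ :=
                  mul_le_mul_of_nonneg_left h4 (mul_nonneg (hμ _ _) (hν _))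
              _ = f w * g w := by simp only [f, g]; ring
        · positivity
    _ ≤ √(∑ w, f w) * √(∑ w, g w) :=
        Real.sum_sqrt_mul_sqrt_le _ (fun w => hf w) (fun w => hg w)
    _ ≤ _ := by
        rw [← Real.sqrt_mul (Finset.sum_nonneg fun w _ => hf w), mul_div_assoc]
        exact Real.sqrt_le_sqrt (mul_le_mul hfs hgs (Finset.sum_nonneg fun w _ => hg w)
          (Finset.sum_nonneg fun a _ => Finset.sum_nonneg fun s _ => hμ a s))

open Classical in
/-- One-shot converse: if the information density between Bob and the other parties is mostly at
most `log K` at the start, but mostly at least `log L` in the target distribution `D`, then the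
target cannot be reached by local operations and public communication. -/
theorem LOPC.le_sum_abs_apply_sub {A B A' B' S : Type} [Fintype A] [Fintype B] [Fintype A']
    [Fintype B'] [Fintype S] (π : LOPC A B A' B')
    {Q : A → B → S → ℝ} (hQ : ∀ a b s, 0 ≤ Q a b s) (hQ1 : ∑ a, ∑ b, ∑ s, Q a b s = 1)
    {pA : A → S → ℝ} (hpA : ∀ a s, 0 ≤ pA a s) (hpA1 : ∑ a, ∑ s, pA a s ≤ 1)
    {pB : B → ℝ} (hpB : ∀ b, 0 ≤ pB b) (hpB1 : ∑ b, pB b ≤ 1)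
    {D : A' → B' → S → ℝ} (hD : ∀ a b s, 0 ≤ D a b s) (hD1 : ∑ a, ∑ b, ∑ s, D a b s = 1)
    {qA : A' → S → ℝ} {qB : B' → ℝ} (hqA : ∀ a s, ∑ b, D a b s ≤ qA a s)
    (hqB : ∀ b, ∑ a, ∑ s, D a b s ≤ qB b)
    {pC : π.Transcript → ℝ} (hC : ∀ c, 0 ≤ pC c) (hC1 : ∑ c, pC c = 1)
    {K L : ℝ} (hK : 0 ≤ K) (hL : 0 < L) (good : A → B → S → Prop) (good' : A' → B' → S → Prop)
    (h : ∀ a b s, good a b s → Q a b s ≤ K * (pA a s * pB b))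
    (h' : ∀ a b s, good' a b s → D a b s ≠ 0 → L * (qA a s * qB b) ≤ D a b s) :
    2 * (1 - (∑ a, ∑ b, ∑ s, if good a b s then 0 else Q a b s) -
        (∑ a, ∑ b, ∑ s, if good' a b s then 0 else D a b s) - √(K / L)) ≤
      ∑ w : A' × B' × S × π.Transcript,
        |π.apply Q w.1 w.2.1 w.2.2.1 w.2.2.2 - D w.1 w.2.1 w.2.2.1 * pC w.2.2.2| := by
  obtain ⟨μ, ν, hμ, hν, hfac⟩ := π.exists_apply_mul_eq hpA hpB
  set QG : A → B → S → ℝ := fun a b s => if good a b s then Q a b s else 0 with hQG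
  set QB : A → B → S → ℝ := fun a b s => if good a b s then 0 else Q a b s with hQB
  have hQG0 : ∀ a b s, 0 ≤ QG a b s := fun a b s => by simp only [QG]; split_ifs <;> simp [hQ]
  have hQB0 : ∀ a b s, 0 ≤ QB a b s := fun a b s => by simp only [QB]; split_ifs <;> simp [hQ]
  have hsplit : ∀ a b s c, π.apply Q a b s c = π.apply QG a b s c + π.apply QB a b s c := by
    intro a b s c
    rw [← LOPC.apply_add]
    congr 1
    funext a b s
    simp only [QG, QB]; split_ifs <;> simp
  have hG : ∀ a b s c, π.apply QG a b s c ≤ K * (μ c a s * ν c b) := by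
    intro a b s c
    rw [← hfac, ← LOPC.apply_const_mul]
    refine π.apply_mono (fun a b s => ?_) _ _ _ _
    simp only [QG]
    split_ifs with hg
    · exact h a b s hg
    · exact mul_nonneg hK (mul_nonneg (hpA a s) (hpB b))
  -- This is `|u - v| = u + v - 2 min u v`, with the minimum bounded by three losses: the bad part
  -- of the start, the bad part of the target, and the overlap of the good parts.
  have hmin : ∀ w : A' × B' × S × π.Transcript,
      π.apply Q w.1 w.2.1 w.2.2.1 w.2.2.2 + D w.1 w.2.1 w.2.2.1 * pC w.2.2.2 -
        2 * (π.apply QB w.1 w.2.1 w.2.2.1 w.2.2.2 +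
          (if good' w.1 w.2.1 w.2.2.1 then 0 else D w.1 w.2.1 w.2.2.1) * pC w.2.2.2 +
          √K * √(pC w.2.2.2) * (if good' w.1 w.2.1 w.2.2.1 then
            √(μ w.2.2.2 w.1 w.2.2.1 * ν w.2.2.2 w.2.1 * D w.1 w.2.1 w.2.2.1) else 0)) ≤
      |π.apply Q w.1 w.2.1 w.2.2.1 w.2.2.2 - D w.1 w.2.1 w.2.2.1 * pC w.2.2.2| := by
    rintro ⟨a, b, s, c⟩
    dsimp only
    rw [hsplit]
    have h1 := π.apply_nonneg hQG0 a b s c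
    have h2 := π.apply_nonneg hQB0 a b s c
    have h3 := hG a b s c
    have h4 := mul_nonneg (hD a b s) (hC c)
    set x := π.apply QG a b s c
    set y := π.apply QB a b s c
    by_cases hg : good' a b s
    · simp only [if_pos hg, zero_mul, add_zero]
      -- The minimum is at most the geometric mean, and `x` is dominated by the product `K μ ν`.
      have h5 : min x (D a b s * pC c) ≤ √K * √(pC c) * √(μ c a s * ν c b * D a b s) := by
        rw [← Real.sqrt_mul hK, ← Real.sqrt_mul (mul_nonneg hK (hC c))]
        refine Real.le_sqrt_of_sq_le ?_
        calc min x (D a b s * pC c) ^ 2 ≤ x * (D a b s * pC c) := by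
              rw [sq]
              exact mul_le_mul (min_le_left _ _) (min_le_right _ _) (le_min h1 h4) h1
          _ ≤ K * (μ c a s * ν c b) * (D a b s * pC c) := mul_le_mul_of_nonneg_right h3 h4
          _ = _ := by ring
      rcases le_total x (D a b s * pC c) with hle | hle
      · rw [min_eq_left hle] at h5
        linarith [neg_abs_le (x + y - D a b s * pC c)]
      · rw [min_eq_right hle] at h5
        linarith [le_abs_self (x + y - D a b s * pC c)]
    · simp only [if_neg hg, mul_zero, add_zero]
      linarith [le_abs_self (x + y - D a b s * pC c)]
  refine le_trans ?_ (Finset.sum_le_sum fun w _ => hmin w)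
  rw [Finset.sum_sub_distrib, Finset.sum_add_distrib, π.sum_apply, hQ1, ← Finset.mul_sum,
    Finset.sum_add_distrib, Finset.sum_add_distrib, π.sum_apply]
  have e1 : ∑ w : A' × B' × S × π.Transcript, D w.1 w.2.1 w.2.2.1 * pC w.2.2.2 = 1 := by
    simp only [Fintype.sum_prod_type, ← Finset.mul_sum, hC1, mul_one, hD1]
  have e2 : ∑ w : A' × B' × S × π.Transcript,
      (if good' w.1 w.2.1 w.2.2.1 then 0 else D w.1 w.2.1 w.2.2.1) * pC w.2.2.2 =
      ∑ a, ∑ b, ∑ s, if good' a b s then 0 else D a b s := by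
    simp only [Fintype.sum_prod_type, ← Finset.mul_sum, hC1, mul_one]
  have e3 : ∑ w : A' × B' × S × π.Transcript, √K * √(pC w.2.2.2) *
      (if good' w.1 w.2.1 w.2.2.1 then
        √(μ w.2.2.2 w.1 w.2.2.1 * ν w.2.2.2 w.2.1 * D w.1 w.2.1 w.2.2.1) else 0) ≤ √(K / L) := by
    have hm : ∀ c, 0 ≤ ∑ a, ∑ s, μ c a s := fun c =>
      Finset.sum_nonneg fun a _ => Finset.sum_nonneg fun s _ => hμ c a s
    have hn : ∀ c, 0 ≤ ∑ b, ν c b := fun c => Finset.sum_nonneg fun b _ => hν c b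
    -- Summed over transcripts, the products have the total mass of the image of `pA ⊗ pB`, which is
    -- at most one.
    have hmn : ∑ c, (∑ a, ∑ s, μ c a s) * (∑ b, ν c b) ≤ 1 := by
      have hs := π.sum_apply (fun a b s => pA a s * pB b)
      simp only [hfac, Fintype.sum_prod_type] at hs
      have e : ∑ c, (∑ a, ∑ s, μ c a s) * (∑ b, ν c b) =
          ∑ a, ∑ b, ∑ s, ∑ c, μ c a s * ν c b := by
        simp only [Finset.sum_mul, Finset.mul_sum]
        rw [Finset.sum_comm, Finset.sum_comm (s := (Finset.univ : Finset A'))]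
        refine Finset.sum_congr rfl fun b _ => ?_
        rw [Finset.sum_comm]
        refine Finset.sum_congr rfl fun a _ => ?_
        rw [Finset.sum_comm]
      rw [e, hs]
      calc ∑ a, ∑ b, ∑ s, pA a s * pB b = (∑ a, ∑ s, pA a s) * ∑ b, pB b := by
            simp only [Finset.sum_mul, Finset.mul_sum]
            exact Finset.sum_comm
        _ ≤ 1 := mul_le_one₀ hpA1 (Finset.sum_nonneg fun b _ => hpB b) hpB1
    have e : ∑ w : A' × B' × S × π.Transcript, √K * √(pC w.2.2.2) *
        (if good' w.1 w.2.1 w.2.2.1 then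
          √(μ w.2.2.2 w.1 w.2.2.1 * ν w.2.2.2 w.2.1 * D w.1 w.2.1 w.2.2.1) else 0) =
        ∑ c, √K * √(pC c) * ∑ a, ∑ b, ∑ s,
          if good' a b s then √(μ c a s * ν c b * D a b s) else 0 := by
      simp only [Fintype.sum_prod_type, Finset.mul_sum]
      symm
      rw [Finset.sum_comm]
      refine Finset.sum_congr rfl fun a _ => ?_
      rw [Finset.sum_comm]
      refine Finset.sum_congr rfl fun b _ => ?_
      rw [Finset.sum_comm]
    rw [e]
    -- The inequality of arithmetic and geometric means, used for each transcript, removes the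
    -- dependence on the arbitrary law `pC`.
    calc _ ≤ ∑ c, √(K / L) * (((∑ a, ∑ s, μ c a s) * (∑ b, ν c b) + pC c) / 2) := by
          refine Finset.sum_le_sum fun c _ => ?_
          have hb := sum_sqrt_mul_mul_le (hμ c) (hν c) hD hqA hqB hL good' h'
          refine (mul_le_mul_of_nonneg_left hb (by positivity)).trans ?_
          have hmc := mul_nonneg (hm c) (hn c)
          set x := (∑ a, ∑ s, μ c a s) * (∑ b, ν c b)
          have : √K * √(pC c) * √(x / L) = √(K / L) * (√x * √(pC c)) := by
            rw [Real.sqrt_div hmc, Real.sqrt_div hK]; ring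
          rw [this]
          refine mul_le_mul_of_nonneg_left ?_ (by positivity)
          nlinarith [sq_nonneg (√x - √(pC c)), Real.sq_sqrt hmc, Real.sq_sqrt (hC c)]
      _ = √(K / L) * ((∑ c, (∑ a, ∑ s, μ c a s) * (∑ b, ν c b) + 1) / 2) := by
          rw [← Finset.mul_sum, ← Finset.sum_div, Finset.sum_add_distrib, hC1]
      _ ≤ √(K / L) * 1 := by
          refine mul_le_mul_of_nonneg_left ?_ (by positivity)
          linarith
      _ = _ := mul_one _
  rw [e1, e2]
  linarith

/-! ### Independent copies -/

theorem keyLaw_eq {m : ℕ} (u v : Fin m → Bool) :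
    keyLaw u v = if u = v then ((2 : ℝ) ^ m)⁻¹ else 0 := by
  unfold keyLaw keyBit
  split_ifs with h
  · subst h; simp
  · obtain ⟨i, hi⟩ := Function.ne_iff.1 h
    exact Finset.prod_eq_zero (Finset.mem_univ i) (if_neg hi)

theorem keyLaw_nonneg {m : ℕ} (u v : Fin m → Bool) : 0 ≤ keyLaw u v := by
  rw [keyLaw_eq]; split_ifs <;> positivity

theorem keyLaw_le {m : ℕ} (u v : Fin m → Bool) : keyLaw u v ≤ ((2 : ℝ) ^ m)⁻¹ := by
  rw [keyLaw_eq]; split_ifs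
  · rfl
  · positivity

theorem sum_keyLaw_right {m : ℕ} (u : Fin m → Bool) :
    ∑ v, keyLaw u v = ((2 : ℝ) ^ m)⁻¹ := by
  simp [keyLaw_eq]

theorem sum_keyLaw_left {m : ℕ} (v : Fin m → Bool) :
    ∑ u, keyLaw u v = ((2 : ℝ) ^ m)⁻¹ := by
  simp [keyLaw_eq]

theorem sum_const_inv_two_pow (m : ℕ) : ∑ _u : Fin m → Bool, ((2 : ℝ) ^ m)⁻¹ = 1 := by
  simp

theorem sum_sum_keyLaw (m : ℕ) : ∑ u : Fin m → Bool, ∑ v, keyLaw u v = 1 := by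
  simp only [sum_keyLaw_right, sum_const_inv_two_pow]

theorem iidLaw_nonneg {X Y Z E : Type} {P : X × Y × Z × E → ℝ} {n : ℕ} (hP : ∀ w, 0 ≤ P w) (x : Fin n → X) (y : Fin n → Y) (z : Fin n → Z)
    (e : Fin n → E) : 0 ≤ iidLaw P x y z e :=
  Finset.prod_nonneg fun _ _ => hP _

section Iid

variable {X Y Z E : Type} [Fintype X] [Fintype Y] [Fintype Z] [Fintype E]
  {P : X × Y × Z × E → ℝ} {n : ℕ}

theorem law_XY (P : X × Y × Z × E → ℝ) (x : X) (y : Y) :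
    law P (fun w => (w.1, w.2.1)) (x, y) = ∑ z, ∑ e, P (x, y, z, e) := by
  classical
  simp only [law, Fintype.sum_prod_type, Prod.mk.injEq]
  rw [Fintype.sum_eq_single x fun x' hx => by simp [hx],
    Fintype.sum_eq_single y fun y' hy => by simp [hy]]
  simp

theorem law_Y (P : X × Y × Z × E → ℝ) (y : Y) :
    law P (fun w => w.2.1) y = ∑ x, ∑ z, ∑ e, P (x, y, z, e) := by
  classical
  simp only [law, Fintype.sum_prod_type]
  refine Finset.sum_congr rfl fun x _ => ?_
  rw [Fintype.sum_eq_single y fun y' hy => by simp [hy]]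
  simp

theorem law_XS (P : X × Y × Z × E → ℝ) (x : X) (z : Z) (e : E) :
    law P (fun w => (w.1, w.2.2)) (x, z, e) = ∑ y, P (x, y, z, e) := by
  classical
  simp [law, Fintype.sum_prod_type, ite_and]

theorem law_S (P : X × Y × Z × E → ℝ) (z : Z) (e : E) :
    law P (fun w => w.2.2) (z, e) = ∑ x, ∑ y, P (x, y, z, e) := by
  classical
  simp [law, Fintype.sum_prod_type, ite_and, Finset.sum_ite_irrel]

theorem sum_iidLaw_S (x : Fin n → X) (y : Fin n → Y) :
    ∑ z, ∑ e, iidLaw P x y z e = ∏ i, law P (fun w => (w.1, w.2.1)) (x i, y i) := by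
  unfold iidLaw
  simp_rw [fun z : Fin n → Z => sum_prod_apply_eq (fun i e => P (x i, y i, z i, e)),
    sum_prod_apply_eq (fun i z => ∑ e, P (x i, y i, z, e)), law_XY]

theorem sum_iidLaw_XY (z : Fin n → Z) (e : Fin n → E) :
    ∑ x, ∑ y, iidLaw P x y z e = ∏ i, law P (fun w => w.2.2) (z i, e i) := by
  unfold iidLaw
  simp_rw [fun x : Fin n → X => sum_prod_apply_eq (fun i y => P (x i, y, z i, e i)),
    sum_prod_apply_eq (fun i x => ∑ y, P (x, y, z i, e i)), law_S]

theorem sum_iidLaw_Y (x : Fin n → X) (z : Fin n → Z) (e : Fin n → E) :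
    ∑ y, iidLaw P x y z e = ∏ i, law P (fun w => (w.1, w.2.2)) (x i, z i, e i) := by
  unfold iidLaw
  simp_rw [sum_prod_apply_eq (fun i y => P (x i, y, z i, e i)), law_XS]

theorem sum_iidLaw_XS (y : Fin n → Y) :
    ∑ x, ∑ z, ∑ e, iidLaw P x y z e = ∏ i, law P (fun w => w.2.1) (y i) := by
  simp_rw [sum_iidLaw_S, law_XY,
    sum_prod_apply_eq (fun i x => ∑ z, ∑ e, P (x, y i, z, e)), law_Y]

theorem sum_iidLaw (hP : P ∈ stdSimplex ℝ (X × Y × Z × E)) :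
    ∑ x : Fin n → X, ∑ y, ∑ z, ∑ e, iidLaw P x y z e = 1 := by
  rw [Finset.sum_comm]
  simp_rw [sum_iidLaw_XS]
  rw [sum_prod_apply_eq (fun _ y => law P (fun w => w.2.1) y)]
  simp [sum_law, hP.2]

theorem sum_fin_arrow_prod (F : (Fin n → X × Y × Z × E) → ℝ) :
    ∑ w, F w = ∑ x : Fin n → X, ∑ y : Fin n → Y, ∑ z : Fin n → Z, ∑ e : Fin n → E,
      F fun i => (x i, y i, z i, e i) := by
  have : ∑ w, F w = ∑ w : (Fin n → X) × (Fin n → Y) × (Fin n → Z) × (Fin n → E),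
      F fun i => (w.1 i, w.2.1 i, w.2.2.1 i, w.2.2.2 i) :=
    Finset.sum_bij' (fun w _ => (fun i => (w i).1, fun i => (w i).2.1, fun i => (w i).2.2.1,
      fun i => (w i).2.2.2)) (fun w _ i => (w.1 i, w.2.1 i, w.2.2.1 i, w.2.2.2 i))
      (by simp) (by simp) (by simp) (by simp) (by simp)
  rw [this]
  simp only [Fintype.sum_prod_type]

theorem rpow_sum_logb {ι : Type*} [Fintype ι] {r : ι → ℝ} (hr : ∀ i, 0 < r i) :
    (2 : ℝ) ^ (∑ i, Real.logb 2 (r i)) = ∏ i, r i := by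
  rw [Real.rpow_sum_of_pos (by norm_num)]
  exact Finset.prod_congr rfl fun i _ => Real.rpow_logb (by norm_num) (by norm_num) (hr i)

/-- The mean of `log r`. -/
noncomputable def meanLog {Ω : Type} [Fintype Ω] (P r : Ω → ℝ) : ℝ :=
  ∑ w, P w * Real.logb 2 (r w)

/-- The variance of `log r`. -/
noncomputable def varLog {Ω : Type} [Fintype Ω] (P r : Ω → ℝ) : ℝ :=
  ∑ w, P w * (Real.logb 2 (r w) - meanLog P r) ^ 2

theorem varLog_nonneg {Ω : Type} [Fintype Ω] {P : Ω → ℝ} (hP : ∀ w, 0 ≤ P w) (r : Ω → ℝ) :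
    0 ≤ varLog P r :=
  Finset.sum_nonneg fun w _ => mul_nonneg (hP w) (sq_nonneg _)

open Classical in
/-- Asymptotic equipartition: the product of independent copies of `r` is probably close to
`2 ^ (n * meanLog P r)`. -/
theorem sum_iidLaw_atypical_le (hP : P ∈ stdSimplex ℝ (X × Y × Z × E))
    {r : X × Y × Z × E → ℝ} (hr : ∀ w, P w ≠ 0 → 0 < r w) {t : ℝ} (ht : 0 < t)
    (good : (Fin n → X) → (Fin n → Y) → (Fin n → Z) → (Fin n → E) → Prop)
    (hgood : ∀ x y z e, iidLaw P x y z e ≠ 0 →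
      (2 : ℝ) ^ (n * meanLog P r - t) ≤ ∏ i, r (x i, y i, z i, e i) →
      ∏ i, r (x i, y i, z i, e i) ≤ (2 : ℝ) ^ (n * meanLog P r + t) → good x y z e) :
    (∑ x, ∑ y, ∑ z, ∑ e, if good x y z e then 0 else iidLaw P x y z e) ≤
      n * varLog P r / t ^ 2 := by
  refine le_trans ?_ (sum_prod_ite_le_of_iid hP (fun w => Real.logb 2 (r w)) n ht)
  rw [sum_fin_arrow_prod]
  refine Finset.sum_le_sum fun x _ => Finset.sum_le_sum fun y _ => Finset.sum_le_sum fun z _ =>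
    Finset.sum_le_sum fun e _ => ?_
  have h0 := iidLaw_nonneg hP.1 x y z e
  by_cases hg : good x y z e
  · rw [if_pos hg]; split_ifs
    · exact h0
    · rfl
  rw [if_neg hg]
  by_cases hz : iidLaw P x y z e = 0
  · rw [hz]; split_ifs
    · exact h0
    · rfl
  have hpos : ∀ i, 0 < r (x i, y i, z i, e i) := fun i =>
    hr _ fun h => hz (Finset.prod_eq_zero (Finset.mem_univ i) h)
  rw [if_pos]
  · rfl
  by_contra! hlt
  obtain ⟨h1, h2⟩ := abs_lt.1 hlt
  refine hg (hgood x y z e hz ?_ ?_) <;> rw [← rpow_sum_logb hpos] <;>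
    refine Real.rpow_le_rpow_of_exponent_le (by norm_num) ?_ <;> unfold meanLog <;> linarith

/-! ### The rate as a difference of information densities -/

theorem law_XS_of_isPrivate (h : IsPrivate P) (x : X) (z : Z) (e : E) :
    law P (fun w => (w.1, w.2.2)) (x, z, e) =
      law P (fun w => (w.1, w.2.2.1)) (x, z) * law P (fun w => w.2.2.2) e := by
  classical
  rw [law_XS]
  have h1 : ∀ y, P (x, y, z, e) = _ := fun y => h x y z e
  simp_rw [h1, ← Finset.sum_mul]
  congr 1
  simp [law, Fintype.sum_prod_type, ite_and, Finset.sum_ite_irrel]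

theorem law_S_of_isPrivate (h : IsPrivate P) (z : Z) (e : E) :
    law P (fun w => w.2.2) (z, e) =
      law P (fun w => w.2.2.1) z * law P (fun w => w.2.2.2) e := by
  classical
  rw [law_S]
  have h1 : ∀ x y, P (x, y, z, e) = _ := fun x y => h x y z e
  simp_rw [h1, ← Finset.sum_mul]
  congr 1
  simp [law, Fintype.sum_prod_type, ite_and, Finset.sum_ite_irrel]

/-- The factor `P(e)` cancels from the ratio `P(x,z,e) / P(z,e)`. -/
theorem condEntropy_eq_of_isPrivate (hP : P ∈ stdSimplex ℝ (X × Y × Z × E)) (h : IsPrivate P) :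
    condEntropy P (fun w => w.1) (fun w => w.2.2.1) =
      condEntropy P (fun w => w.1) (fun w => w.2.2) := by
  simp only [condEntropy, entropy_eq, neg_sub_neg, ← Finset.sum_sub_distrib, ← mul_sub]
  refine Finset.sum_congr rfl fun w _ => ?_
  by_cases h0 : P w = 0
  · rw [h0, zero_mul, zero_mul]
  have h1 := law_apply_pos hP.1 (fun w => (w.1, w.2.2.1)) h0
  have h2 := law_apply_pos hP.1 (fun w => w.2.2.1) h0
  have h3 := law_apply_pos hP.1 (fun w => w.2.2.2) h0
  obtain ⟨x, y, z, e⟩ := w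
  dsimp only at *
  rw [law_XS_of_isPrivate h, law_S_of_isPrivate h, Real.logb_mul h1.ne' h3.ne',
    Real.logb_mul h2.ne' h3.ne']
  ring

theorem infoXZ_sub_infoXY (P : X × Y × Z × E → ℝ) :
    infoXZ P - infoXY P = condEntropy P (fun w => w.1) (fun w => w.2.1) -
      condEntropy P (fun w => w.1) (fun w => w.2.2.1) := by
  simp only [infoXZ, infoXY, mutualInfo, condEntropy]
  ring

/-- The ratio `P(f, g) / P(g)`. -/
noncomputable def condRatio {Ω β γ : Type} [Fintype Ω] (P : Ω → ℝ) (f : Ω → β) (g : Ω → γ)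
    (w : Ω) : ℝ :=
  law P (fun w => (f w, g w)) (f w, g w) / law P g (g w)

theorem condRatio_pos {Ω β γ : Type} [Fintype Ω] {P : Ω → ℝ} (hP : ∀ w, 0 ≤ P w) (f : Ω → β)
    (g : Ω → γ) {w : Ω} (hw : P w ≠ 0) : 0 < condRatio P f g w :=
  div_pos (law_apply_pos hP (fun w => (f w, g w)) hw) (law_apply_pos hP g hw)

theorem meanLog_condRatio {Ω β γ : Type} [Fintype Ω] [Fintype β] [Fintype γ] {P : Ω → ℝ}
    (hP : ∀ w, 0 ≤ P w) (f : Ω → β) (g : Ω → γ) :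
    meanLog P (condRatio P f g) = -condEntropy P f g := by
  simp only [condEntropy, entropy_eq, meanLog, ← Finset.sum_neg_distrib,
    ← Finset.sum_sub_distrib]
  refine Finset.sum_congr rfl fun w _ => ?_
  by_cases h0 : P w = 0
  · simp [h0]
  rw [condRatio, Real.logb_div (law_apply_pos hP (fun w => (f w, g w)) h0).ne'
    (law_apply_pos hP g h0).ne']
  ring

/-- The ratio of `P` to the product of two marginals. -/
noncomputable def infoRatio {Ω β γ : Type} [Fintype Ω] (P : Ω → ℝ) (f : Ω → β) (g : Ω → γ)
    (w : Ω) : ℝ :=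
  P w / (law P f (f w) * law P g (g w))

theorem infoRatio_pos {Ω β γ : Type} [Fintype Ω] {P : Ω → ℝ} (hP : ∀ w, 0 ≤ P w) (f : Ω → β)
    (g : Ω → γ) {w : Ω} (hw : P w ≠ 0) : 0 < infoRatio P f g w :=
  div_pos (lt_of_le_of_ne (hP w) hw.symm) (mul_pos (law_apply_pos hP f hw) (law_apply_pos hP g hw))

theorem meanLog_infoRatio {Ω β γ : Type} [Fintype Ω] [Fintype β] [Fintype γ] {P : Ω → ℝ}
    (hP : ∀ w, 0 ≤ P w) (f : Ω → β) (g : Ω → γ) :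
    meanLog P (infoRatio P f g) = entropy P f + entropy P g + meanLog P P := by
  simp only [entropy_eq, meanLog, ← Finset.sum_neg_distrib, ← Finset.sum_add_distrib]
  refine Finset.sum_congr rfl fun w _ => ?_
  by_cases h0 : P w = 0
  · simp [h0]
  have h1 := law_apply_pos hP f h0
  have h2 := law_apply_pos hP g h0
  rw [infoRatio, Real.logb_div h0 (mul_pos h1 h2).ne', Real.logb_mul h1.ne' h2.ne']
  ring

/-- The joint entropy occurs in both means and cancels. What is left is `H(XY) + H(ZE) - H(XZE) -
H(Y)`, that is `H(X|Y) - H(X|ZE)`. -/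
theorem meanLog_infoRatio_sub (hP : P ∈ stdSimplex ℝ (X × Y × Z × E)) (h : IsPrivate P) :
    meanLog P (infoRatio P (fun w => (w.1, w.2.1)) (fun w => w.2.2)) -
        meanLog P (infoRatio P (fun w => (w.1, w.2.2)) (fun w => w.2.1)) =
      infoXZ P - infoXY P := by
  rw [infoXZ_sub_infoXY, condEntropy_eq_of_isPrivate hP h, meanLog_infoRatio hP.1,
    meanLog_infoRatio hP.1, condEntropy, condEntropy]
  ring

end Iid

/-! ### The converse -/

theorem sum_mul_inv_two_pow {A : Type} [Fintype A] (m : ℕ) (F : A → ℝ) :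
    ∑ a : A × (Fin m → Bool), F a.1 * ((2 : ℝ) ^ m)⁻¹ = ∑ a, F a := by
  simp only [Fintype.sum_prod_type, ← Finset.mul_sum, sum_const_inv_two_pow, mul_one]

theorem sum_mul_keyLaw_initial {A B S : Type} [Fintype A] [Fintype B] [Fintype S] {m : ℕ}
    (F : A → B → S → ℝ) :
    ∑ a : A × (Fin m → Bool), ∑ b : B × (Fin m → Bool), ∑ s, F a.1 b.1 s * keyLaw a.2 b.2 =
      ∑ a, ∑ b, ∑ s, F a b s := by
  simp only [Fintype.sum_prod_type]
  refine Finset.sum_congr rfl fun a _ => ?_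
  rw [Finset.sum_comm]
  refine Finset.sum_congr rfl fun b _ => ?_
  simp only [← Finset.sum_mul]
  simp only [← Finset.mul_sum, sum_sum_keyLaw, mul_one]

theorem sum_mul_keyLaw_final {A B S : Type} [Fintype A] [Fintype B] [Fintype S] {m : ℕ}
    (F : A → B → S → ℝ) :
    ∑ u : Fin m → Bool, ∑ b : A × B × (Fin m → Bool), ∑ s, F b.1 b.2.1 s * keyLaw u b.2.2 =
      ∑ a, ∑ b, ∑ s, F a b s := by
  simp only [Fintype.sum_prod_type]
  rw [Finset.sum_comm]
  refine Finset.sum_congr rfl fun a _ => ?_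
  rw [Finset.sum_comm]
  refine Finset.sum_congr rfl fun b _ => ?_
  simp only [← Finset.sum_mul]
  simp only [← Finset.mul_sum, sum_sum_keyLaw, mul_one]

namespace MergingProtocol

variable {X Y Z E : Type} [Fintype X] [Fintype Y] [Fintype Z] [Fintype E]
  {P : X × Y × Z × E → ℝ} {n k l : ℕ}

theorem actual_nonneg {Z E : Type} {P : X × Y × Z × E → ℝ} (hP : ∀ w, 0 ≤ P w) (π : MergingProtocol X Y n k l) (w : Final Z E π) :
    0 ≤ π.actual P w :=
  LOPC.apply_nonneg π (fun _ _ _ => mul_nonneg (iidLaw_nonneg hP _ _ _ _) (keyLaw_nonneg _ _))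
    _ _ _ _

theorem sum_initial (hP : P ∈ stdSimplex ℝ (X × Y × Z × E)) :
    ∑ a : (Fin n → X) × (Fin k → Bool), ∑ b : (Fin n → Y) × (Fin k → Bool),
      ∑ s : (Fin n → Z) × (Fin n → E), iidLaw P a.1 b.1 s.1 s.2 * keyLaw a.2 b.2 = 1 := by
  rw [sum_mul_keyLaw_initial fun x y (s : (Fin n → Z) × (Fin n → E)) => iidLaw P x y s.1 s.2]
  simp only [Fintype.sum_prod_type, sum_iidLaw hP]

theorem sum_target (hP : P ∈ stdSimplex ℝ (X × Y × Z × E)) :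
    ∑ u : Fin l → Bool, ∑ b : (Fin n → X) × (Fin n → Y) × (Fin l → Bool),
      ∑ s : (Fin n → Z) × (Fin n → E), iidLaw P b.1 b.2.1 s.1 s.2 * keyLaw u b.2.2 = 1 := by
  rw [sum_mul_keyLaw_final fun x y (s : (Fin n → Z) × (Fin n → E)) => iidLaw P x y s.1 s.2]
  simp only [Fintype.sum_prod_type, sum_iidLaw hP]

theorem sum_actual (hP : P ∈ stdSimplex ℝ (X × Y × Z × E)) (π : MergingProtocol X Y n k l) :
    ∑ w : Final Z E π, π.actual P w = 1 :=
  (LOPC.sum_apply π _).trans (sum_initial hP)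

/-- The one-shot converse for `n` copies: the cut separates Bob from the rest, and Chebyshev's
inequality with deviation `t` bounds the atypical parts of start and target. -/
theorem le_error (hP : P ∈ stdSimplex ℝ (X × Y × Z × E)) (π : MergingProtocol X Y n k l)
    {t : ℝ} (ht : 0 < t) :
    2 * (1 - n * varLog P (infoRatio P (fun w => (w.1, w.2.2)) (fun w => w.2.1)) / t ^ 2 -
        n * varLog P (infoRatio P (fun w => (w.1, w.2.1)) (fun w => w.2.2)) / t ^ 2 -
        √((2 ^ k *
            2 ^ (n * meanLog P (infoRatio P (fun w => (w.1, w.2.2)) (fun w => w.2.1)) + t)) /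
          (2 ^ l *
            2 ^ (n * meanLog P (infoRatio P (fun w => (w.1, w.2.1)) (fun w => w.2.2)) - t)))) ≤
      π.error P := by
  classical
  set r₁ := infoRatio P (fun w => (w.1, w.2.2)) (fun w => w.2.1) with hr₁
  set r₂ := infoRatio P (fun w => (w.1, w.2.1)) (fun w => w.2.2) with hr₂
  have hr₁pos : ∀ w, P w ≠ 0 → 0 < r₁ w := fun w hw => infoRatio_pos hP.1 _ _ hw
  have hr₂pos : ∀ w, P w ≠ 0 → 0 < r₂ w := fun w hw => infoRatio_pos hP.1 _ _ hw
  have hprod : ∀ {β : Type} [Fintype β] (f : X × Y × Z × E → β) (b : Fin n → β),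
      0 ≤ ∏ i, law P f (b i) := fun f b => Finset.prod_nonneg fun i _ => law_nonneg hP.1 f _
  have hfac : ∀ {β γ : Type} [Fintype β] [Fintype γ] (f : X × Y × Z × E → β)
      (g : X × Y × Z × E → γ) (w : Fin n → X × Y × Z × E), ∏ i, P (w i) ≠ 0 →
      0 < (∏ i, law P f (f (w i))) * ∏ i, law P g (g (w i)) := by
    intro β γ _ _ f g w hw
    have := Finset.prod_ne_zero_iff.1 hw
    exact mul_pos (Finset.prod_pos fun i hi => law_apply_pos hP.1 f (this i hi))
      (Finset.prod_pos fun i hi => law_apply_pos hP.1 g (this i hi))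
  -- One-sided typicality suffices: a density bounded above at the start and bounded below in the
  -- target.
  let good₁ : (Fin n → X) → (Fin n → Y) → (Fin n → Z) → (Fin n → E) → Prop := fun x y z e =>
    iidLaw P x y z e ≤ 2 ^ (n * meanLog P r₁ + t) *
      ((∏ i, law P (fun w => (w.1, w.2.2)) (x i, z i, e i)) * ∏ i, law P (fun w => w.2.1) (y i))
  let good₂ : (Fin n → X) → (Fin n → Y) → (Fin n → Z) → (Fin n → E) → Prop := fun x y z e =>
    2 ^ (n * meanLog P r₂ - t) *
      ((∏ i, law P (fun w => (w.1, w.2.1)) (x i, y i)) * ∏ i, law P (fun w => w.2.2) (z i, e i)) ≤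
      iidLaw P x y z e
  have bad₁ := sum_iidLaw_atypical_le (n := n) hP hr₁pos ht good₁ (by
    intro x y z e h0 _ h
    have hp := hfac (fun w => (w.1, w.2.2)) (fun w => w.2.1) _ h0
    rw [hr₁] at h
    simp only [infoRatio, Finset.prod_div_distrib, Finset.prod_mul_distrib] at h
    exact (div_le_iff₀ hp).1 h)
  have bad₂ := sum_iidLaw_atypical_le (n := n) hP hr₂pos ht good₂ (by
    intro x y z e h0 h _
    have hp := hfac (fun w => (w.1, w.2.1)) (fun w => w.2.2) _ h0
    rw [hr₂] at h
    simp only [infoRatio, Finset.prod_div_distrib, Finset.prod_mul_distrib] at h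
    exact (le_div_iff₀ hp).1 h)
  have main := LOPC.le_sum_abs_apply_sub π
    (Q := fun (a : (Fin n → X) × (Fin k → Bool)) (b : (Fin n → Y) × (Fin k → Bool))
      (s : (Fin n → Z) × (Fin n → E)) => iidLaw P a.1 b.1 s.1 s.2 * keyLaw a.2 b.2)
    (fun _ _ _ => mul_nonneg (iidLaw_nonneg hP.1 _ _ _ _) (keyLaw_nonneg _ _))
    (sum_initial hP)
    (pA := fun a s => (∏ i, law P (fun w => (w.1, w.2.2)) (a.1 i, s.1 i, s.2 i)) * (2 ^ k)⁻¹)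
    (fun _ _ => mul_nonneg (hprod (fun w => (w.1, w.2.2)) fun i => (_, _, _)) (by positivity))
    (by
      simp only [← Finset.sum_mul]
      rw [Finset.sum_mul, sum_mul_inv_two_pow k fun x : Fin n → X => ∑ s : (Fin n → Z) × (Fin n → E),
        ∏ i, law P (fun w => (w.1, w.2.2)) (x i, s.1 i, s.2 i)]
      simp only [Fintype.sum_prod_type, ← sum_iidLaw_Y]
      refine le_of_eq ?_
      rw [← sum_iidLaw (n := n) hP]
      refine Finset.sum_congr rfl fun x _ => ?_
      symm
      rw [Finset.sum_comm]
      exact Finset.sum_congr rfl fun z _ => Finset.sum_comm)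
    (pB := fun b => (∏ i, law P (fun w => w.2.1) (b.1 i)) * (2 ^ k)⁻¹)
    (fun _ => mul_nonneg (hprod (fun w => w.2.1) _) (by positivity))
    (by
      rw [sum_mul_inv_two_pow k fun y : Fin n → Y => ∏ i, law P (fun w => w.2.1) (y i)]
      simp only [← sum_iidLaw_XS]
      rw [Finset.sum_comm, sum_iidLaw hP])
    (D := fun u (b : (Fin n → X) × (Fin n → Y) × (Fin l → Bool))
      (s : (Fin n → Z) × (Fin n → E)) => iidLaw P b.1 b.2.1 s.1 s.2 * keyLaw u b.2.2)
    (fun _ _ _ => mul_nonneg (iidLaw_nonneg hP.1 _ _ _ _) (keyLaw_nonneg _ _))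
    (sum_target hP)
    (qA := fun _ s => (∏ i, law P (fun w => w.2.2) (s.1 i, s.2 i)) * (2 ^ l)⁻¹)
    (qB := fun b => (∏ i, law P (fun w => (w.1, w.2.1)) (b.1 i, b.2.1 i)) * (2 ^ l)⁻¹)
    (fun u s => by
      simp only [Fintype.sum_prod_type, ← Finset.mul_sum, sum_keyLaw_right, ← Finset.sum_mul,
        sum_iidLaw_XY]
      rfl)
    (fun b => by
      simp only [Fintype.sum_prod_type, ← Finset.sum_mul, ← Finset.mul_sum, sum_keyLaw_left,
        sum_iidLaw_S]
      rfl)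
    (pC := law (π.actual P) fun w' => w'.2.2.2)
    (law_nonneg (actual_nonneg hP.1 π) _)
    ((sum_law _ _).trans (sum_actual hP π))
    -- Perfect key of `k` bits has density `2 ^ k` with respect to its uniform marginals, hence the
    -- additional factors `2 ^ k` and `2 ^ l`.
    (K := 2 ^ k * 2 ^ (n * meanLog P r₁ + t)) (L := 2 ^ l * 2 ^ (n * meanLog P r₂ - t))
    (by positivity) (by positivity)
    (fun a b s => good₁ a.1 b.1 s.1 s.2) (fun _ b s => good₂ b.1 b.2.1 s.1 s.2)
    (fun a b s hg => by
      refine (mul_le_mul hg (keyLaw_le _ _) (keyLaw_nonneg _ _)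
        ((iidLaw_nonneg hP.1 _ _ _ _).trans hg)).trans_eq ?_
      field_simp)
    (fun u b s hg h0 => by
      have h1 : u = b.2.2 := by
        by_contra h; exact h0 (by rw [keyLaw_eq, if_neg h, mul_zero])
      rw [keyLaw_eq, if_pos h1]
      refine le_trans (le_of_eq ?_) (mul_le_mul_of_nonneg_right hg (by positivity))
      field_simp)
  refine le_trans ?_ main
  have e₁ : (∑ a : (Fin n → X) × (Fin k → Bool), ∑ b : (Fin n → Y) × (Fin k → Bool),
      ∑ s : (Fin n → Z) × (Fin n → E), if good₁ a.1 b.1 s.1 s.2 then (0 : ℝ) else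
        iidLaw P a.1 b.1 s.1 s.2 * keyLaw a.2 b.2) =
      ∑ x, ∑ y, ∑ z, ∑ e, if good₁ x y z e then 0 else iidLaw P x y z e := by
    have := sum_mul_keyLaw_initial (m := k) fun x y (s : (Fin n → Z) × (Fin n → E)) =>
      if good₁ x y s.1 s.2 then 0 else iidLaw P x y s.1 s.2
    simp only [ite_mul, zero_mul] at this
    rw [this]
    simp only [Fintype.sum_prod_type]
  have e₂ : (∑ u : Fin l → Bool, ∑ b : (Fin n → X) × (Fin n → Y) × (Fin l → Bool),
      ∑ s : (Fin n → Z) × (Fin n → E), if good₂ b.1 b.2.1 s.1 s.2 then (0 : ℝ) else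
        iidLaw P b.1 b.2.1 s.1 s.2 * keyLaw u b.2.2) =
      ∑ x, ∑ y, ∑ z, ∑ e, if good₂ x y z e then 0 else iidLaw P x y z e := by
    have := sum_mul_keyLaw_final (m := l) fun x y (s : (Fin n → Z) × (Fin n → E)) =>
      if good₂ x y s.1 s.2 then 0 else iidLaw P x y s.1 s.2
    simp only [ite_mul, zero_mul] at this
    rw [this]
    simp only [Fintype.sum_prod_type]
  rw [e₁, e₂]
  linarith

end MergingProtocol

theorem MergingScheme.eventually_le_rate {X Y Z E : Type} [Fintype X] [Fintype Y] [Fintype Z]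
    [Fintype E] {P : X × Y × Z × E → ℝ} (hP : P ∈ stdSimplex ℝ (X × Y × Z × E))
    (hprivate : IsPrivate P) (S : MergingScheme P) {δ : ℝ} (hδ : 0 < δ) :
    ∀ᶠ n : ℕ in atTop, infoXZ P - infoXY P - δ ≤ S.rate n := by
  have hR := meanLog_infoRatio_sub hP hprivate
  have hV := fun r => varLog_nonneg hP.1 r
  set m₁ := meanLog P (infoRatio P (fun w => (w.1, w.2.2)) (fun w => w.2.1)) with hm₁
  set m₂ := meanLog P (infoRatio P (fun w => (w.1, w.2.1)) (fun w => w.2.2)) with hm₂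
  set V := varLog P (infoRatio P (fun w => (w.1, w.2.2)) (fun w => w.2.1)) +
    varLog P (infoRatio P (fun w => (w.1, w.2.1)) (fun w => w.2.2)) with hVdef
  have lim₁ : Tendsto (fun n : ℕ => V / (δ / 4) ^ 2 / (n : ℝ)) atTop (𝓝 0) :=
    tendsto_const_div_atTop_nhds_zero_nat _
  have lim₂ : Tendsto (fun n : ℕ => ((2 : ℝ) ^ (-(δ / 4))) ^ n) atTop (𝓝 0) :=
    tendsto_pow_atTop_nhds_zero_of_lt_one (by positivity)
      (Real.rpow_lt_one_of_one_lt_of_neg (by norm_num) (by linarith))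
  filter_upwards [S.error_tendsto.eventually (gt_mem_nhds (show (0 : ℝ) < 1 by norm_num)),
    lim₁.eventually (gt_mem_nhds (show (0 : ℝ) < 1 / 4 by norm_num)),
    lim₂.eventually (gt_mem_nhds (show (0 : ℝ) < 1 / 4 by norm_num)),
    eventually_gt_atTop 0] with n h1 h2 h3 h4
  -- The variance terms together and the square root will each be below `1/4`, so the error would
  -- exceed `2 (1 - 1/4 - 1/4) = 1`.
  by_contra! hlt
  have hn : (0 : ℝ) < n := by exact_mod_cast h4
  rw [MergingScheme.rate, div_lt_iff₀ hn] at hlt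
  have hle := (S.protocol n).le_error hP (t := n * (δ / 4)) (by positivity)
  rw [← hm₁, ← hm₂] at hle
  -- A rate below `R₀ - δ` makes the exponent of the quotient less than `-nδ + 2t = -nδ/2`; the
  -- square root halves it.
  have e1 : √((2 ^ S.k n * (2 : ℝ) ^ (n * m₁ + n * (δ / 4))) /
      (2 ^ S.l n * 2 ^ (n * m₂ - n * (δ / 4)))) ≤ ((2 : ℝ) ^ (-(δ / 4))) ^ n := by
    rw [Real.sqrt_le_left (by positivity), ← pow_mul, ← Real.rpow_natCast, ← Real.rpow_natCast,
      ← Real.rpow_natCast, ← Real.rpow_mul (by norm_num), ← Real.rpow_add (by norm_num),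
      ← Real.rpow_add (by norm_num), ← Real.rpow_sub (by norm_num)]
    refine Real.rpow_le_rpow_of_exponent_le (by norm_num) ?_
    push_cast
    rw [← hR] at hlt
    nlinarith
  have e2 : n * varLog P (infoRatio P (fun w => (w.1, w.2.2)) (fun w => w.2.1)) /
        (n * (δ / 4)) ^ 2 +
      n * varLog P (infoRatio P (fun w => (w.1, w.2.1)) (fun w => w.2.2)) / (n * (δ / 4)) ^ 2 =
      V / (δ / 4) ^ 2 / n := by
    rw [hVdef]; field_simp
  linarith

/-! ### Random hashing -/

section Hashing

variable {X V M : Type} [Fintype X] [DecidableEq X] [Fintype V] [Fintype M] [DecidableEq M]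
  {ρ : V → ℝ} {h : V → M}

/-- The hash values at two distinct points are independent and uniform, so each common value `m`
contributes the squared inverse of the cardinality. -/
theorem sum_prod_mul_ite_eq (hρ1 : ∑ v, ρ v = 1)
    (hh : ∀ m, (∑ v, ρ v * if h v = m then 1 else 0) = (Fintype.card M : ℝ)⁻¹)
    (hM : Fintype.card M ≠ 0) {x x' : X} (hx : x' ≠ x) :
    (∑ Φ : X → V, (∏ x, ρ (Φ x)) * if h (Φ x') = h (Φ x) then 1 else 0) =
      (Fintype.card M : ℝ)⁻¹ := by
  have e : ∀ Φ : X → V, ((∏ x, ρ (Φ x)) * if h (Φ x') = h (Φ x) then (1 : ℝ) else 0) =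
      ∑ m, (∏ x, ρ (Φ x)) *
        ((if h (Φ x') = m then 1 else 0) * (if h (Φ x) = m then 1 else 0)) := by
    intro Φ
    rw [← Finset.mul_sum]
    congr 1
    simp [eq_comm]
  simp only [e]
  rw [Finset.sum_comm]
  have e' : ∀ m, ∑ Φ : X → V, (∏ x, ρ (Φ x)) *
      ((if h (Φ x') = m then (1 : ℝ) else 0) * (if h (Φ x) = m then 1 else 0)) =
      (Fintype.card M : ℝ)⁻¹ * (Fintype.card M : ℝ)⁻¹ := fun m => by
    rw [sum_prod_mul_apply_mul_apply (ρ := fun _ => ρ) (fun _ => hρ1) hx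
      (fun v => if h v = m then (1 : ℝ) else 0) (fun v => if h v = m then (1 : ℝ) else 0), hh]
  simp only [e', Finset.sum_const, Finset.card_univ, nsmul_eq_mul]
  have : (Fintype.card M : ℝ) ≠ 0 := by exact_mod_cast hM
  field_simp

open Classical in
/-- The probability that some other candidate has the same hash value. -/
theorem sum_prod_mul_collision_le {Y : Type} [Fintype Y] (hρ : ∀ v, 0 ≤ ρ v)
    (hρ1 : ∑ v, ρ v = 1)
    (hh : ∀ m, (∑ v, ρ v * if h v = m then 1 else 0) = (Fintype.card M : ℝ)⁻¹)
    (hM : Fintype.card M ≠ 0) {q : X → Y → ℝ} (hq : ∀ x y, 0 ≤ q x y) (good : X → Y → Prop)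
    {N : ℝ} (hN : ∀ y, (∑ x, if good x y then (1 : ℝ) else 0) ≤ N) :
    (∑ Φ : X → V, (∏ x, ρ (Φ x)) *
      ∑ x, ∑ y, if ∃ x', x' ≠ x ∧ good x' y ∧ h (Φ x') = h (Φ x) then q x y else 0) ≤
      (∑ x, ∑ y, q x y) * (N * (Fintype.card M : ℝ)⁻¹) := by
  have hw : ∀ Φ : X → V, 0 ≤ ∏ x, ρ (Φ x) := fun Φ => Finset.prod_nonneg fun _ _ => hρ _
  -- Union bound over the competing candidates `x'`.
  calc _ ≤ ∑ Φ : X → V, (∏ x, ρ (Φ x)) * ∑ x, ∑ y, ∑ x' ∈ Finset.univ.erase x,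
        (q x y * if good x' y then 1 else 0) * if h (Φ x') = h (Φ x) then 1 else 0 := by
        refine Finset.sum_le_sum fun Φ _ => mul_le_mul_of_nonneg_left ?_ (hw Φ)
        refine Finset.sum_le_sum fun x _ => Finset.sum_le_sum fun y _ => ?_
        have h0 : ∀ x' ∈ Finset.univ.erase x, 0 ≤ (q x y * if good x' y then (1 : ℝ) else 0) *
            if h (Φ x') = h (Φ x) then 1 else 0 := fun x' _ => by
          have := hq x y
          positivity
        split_ifs with hc
        · obtain ⟨x', hx', hg, he⟩ := hc
          have := Finset.single_le_sum h0 (Finset.mem_erase.2 ⟨hx', Finset.mem_univ x'⟩)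
          simpa [hg, he] using this
        · exact Finset.sum_nonneg h0
    _ = ∑ x, ∑ y, ∑ x' ∈ Finset.univ.erase x, (q x y * if good x' y then 1 else 0) *
          ∑ Φ : X → V, (∏ x, ρ (Φ x)) * if h (Φ x') = h (Φ x) then 1 else 0 := by
        simp only [Finset.mul_sum]
        rw [Finset.sum_comm]
        refine Finset.sum_congr rfl fun x _ => ?_
        rw [Finset.sum_comm]
        refine Finset.sum_congr rfl fun y _ => ?_
        rw [Finset.sum_comm]
        refine Finset.sum_congr rfl fun x' _ => Finset.sum_congr rfl fun Φ _ => ?_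
        ring
    _ = ∑ x, ∑ y, ∑ x' ∈ Finset.univ.erase x, (q x y * if good x' y then 1 else 0) *
          (Fintype.card M : ℝ)⁻¹ := by
        refine Finset.sum_congr rfl fun x _ => Finset.sum_congr rfl fun y _ =>
          Finset.sum_congr rfl fun x' hx' => ?_
        rw [sum_prod_mul_ite_eq hρ1 hh hM (Finset.mem_erase.1 hx').1]
    _ ≤ ∑ x, ∑ y, q x y * (N * (Fintype.card M : ℝ)⁻¹) := by
        refine Finset.sum_le_sum fun x _ => Finset.sum_le_sum fun y _ => ?_
        rw [← Finset.sum_mul, ← Finset.mul_sum, mul_assoc]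
        refine mul_le_mul_of_nonneg_left (mul_le_mul_of_nonneg_right ?_ (by positivity)) (hq x y)
        refine le_trans ?_ (hN y)
        exact Finset.sum_le_sum_of_subset_of_nonneg (Finset.erase_subset _ _)
          fun x' _ _ => by positivity
    _ = _ := by simp only [Finset.sum_mul]

open Classical in
/-- Leftover hashing: the distance of the hash value from a uniform variable that is independent
of the side information. -/
theorem sum_prod_mul_sum_abs_sub_le {S : Type} [Fintype S] (hρ : ∀ v, 0 ≤ ρ v)
    (hρ1 : ∑ v, ρ v = 1)
    (hh : ∀ m, (∑ v, ρ v * if h v = m then 1 else 0) = (Fintype.card M : ℝ)⁻¹)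
    (hM : Fintype.card M ≠ 0) {q : X → S → ℝ} (hq : ∀ x s, 0 ≤ q x s)
    {qS : S → ℝ} (hqS : ∀ s, ∑ x, q x s = qS s) (hqS1 : ∑ s, qS s ≤ 1)
    (good : X → S → Prop) {η : ℝ} (hη : 0 ≤ η) (hgood : ∀ x s, good x s → q x s ≤ η * qS s) :
    (∑ Φ : X → V, (∏ x, ρ (Φ x)) * ∑ s, ∑ m,
      |(∑ x, q x s * if h (Φ x) = m then 1 else 0) - qS s * (Fintype.card M : ℝ)⁻¹|) ≤
      2 * (∑ x, ∑ s, if good x s then 0 else q x s) + √(η * Fintype.card M) := by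
  have hw : ∀ Φ : X → V, 0 ≤ ∏ x, ρ (Φ x) := fun Φ => Finset.prod_nonneg fun _ _ => hρ _
  have hw1 : ∑ Φ : X → V, ∏ x, ρ (Φ x) = 1 := by
    rw [sum_prod_apply_eq fun _ v => ρ v]; simp [hρ1]
  have hMpos : (0 : ℝ) < Fintype.card M := by exact_mod_cast Nat.pos_of_ne_zero hM
  have hqS0 : ∀ s, 0 ≤ qS s := fun s => hqS s ▸ Finset.sum_nonneg fun x _ => hq x s
  set c : ℝ := (Fintype.card M : ℝ)⁻¹ with hc
  have hc0 : 0 ≤ c := by positivity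
  -- The bad part `b` is estimated trivially, at cost twice its mass; the bound `η` on the
  -- conditional probabilities is available for the good part `g`.
  set g : X → S → ℝ := fun x s => if good x s then q x s else 0 with hg
  set b : X → S → ℝ := fun x s => if good x s then 0 else q x s with hb
  have hb0 : ∀ x s, 0 ≤ b x s := fun x s => by simp only [b]; split_ifs <;> simp [hq]
  have hg0 : ∀ x s, 0 ≤ g x s := fun x s => by simp only [g]; split_ifs <;> simp [hq]
  have hgle : ∀ x s, g x s ≤ η * qS s := fun x s => by
    simp only [g]; split_ifs with h'
    · exact hgood x s h'
    · exact mul_nonneg hη (hqS0 s)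
  have hgb : ∀ x s, q x s = g x s + b x s := fun x s => by simp only [g, b]; split_ifs <;> simp
  have hgs : ∀ s, ∑ x, g x s ≤ qS s := fun s => by
    rw [← hqS s]
    exact Finset.sum_le_sum fun x _ => by rw [hgb]; linarith [hb0 x s]
  have hsplit : ∀ (Φ : X → V) s m,
      |(∑ x, q x s * if h (Φ x) = m then 1 else 0) - qS s * c| ≤
        |∑ x, g x s * ((if h (Φ x) = m then 1 else 0) - c)| +
          ∑ x, b x s * ((if h (Φ x) = m then 1 else 0) + c) := by
    intro Φ s m
    have e : (∑ x, q x s * if h (Φ x) = m then 1 else 0) - qS s * c =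
        ∑ x, g x s * ((if h (Φ x) = m then 1 else 0) - c) +
        ∑ x, b x s * ((if h (Φ x) = m then 1 else 0) - c) := by
      rw [← hqS s, Finset.sum_mul, ← Finset.sum_sub_distrib, ← Finset.sum_add_distrib]
      refine Finset.sum_congr rfl fun x _ => ?_
      rw [hgb]; ring
    rw [e]
    refine (abs_add_le _ _).trans (add_le_add_right ?_ _)
    refine (Finset.abs_sum_le_sum_abs _ _).trans (Finset.sum_le_sum fun x _ => ?_)
    rw [abs_mul, abs_of_nonneg (hb0 x s)]
    refine mul_le_mul_of_nonneg_left ?_ (hb0 x s)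
    refine (abs_sub _ _).trans (le_of_eq ?_)
    rw [abs_of_nonneg hc0, abs_of_nonneg (by positivity)]
  have hbad : ∀ (Φ : X → V), ∑ s, ∑ m, ∑ x, b x s * ((if h (Φ x) = m then 1 else 0) + c) =
      2 * ∑ x, ∑ s, b x s := by
    intro Φ
    rw [Finset.sum_comm (f := b), Finset.mul_sum]
    refine Finset.sum_congr rfl fun s _ => ?_
    rw [Finset.sum_comm, Finset.mul_sum]
    refine Finset.sum_congr rfl fun x _ => ?_
    rw [← Finset.mul_sum, Finset.sum_add_distrib]
    simp [hc, hMpos.ne']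
    ring
  have hmean : ∀ m, ∑ v, ρ v * ((if h v = m then 1 else 0) - c) = 0 := fun m => by
    simp only [mul_sub, Finset.sum_sub_distrib, hh, ← Finset.sum_mul, hρ1, hc]; ring
  have hvar : ∀ s m, ∑ Φ : X → V, (∏ x, ρ (Φ x)) *
      (∑ x, g x s * ((if h (Φ x) = m then 1 else 0) - c)) ^ 2 ≤ η * c * qS s ^ 2 := by
    intro s m
    rw [sum_prod_mul_sq_sum (ρ := fun _ : X => ρ) (fun _ => hρ1)
      (fun x v => g x s * ((if h v = m then 1 else 0) - c)) (fun x => by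
        have : ∀ v, ρ v * (g x s * ((if h v = m then 1 else 0) - c)) =
          g x s * (ρ v * ((if h v = m then 1 else 0) - c)) := fun v => by ring
        simp only [this, ← Finset.mul_sum, hmean, mul_zero])]
    -- An indicator of mean `c` has variance `c - c²`, which is at most `c`.
    have e : ∀ x, ∑ v, ρ v * (g x s * ((if h v = m then 1 else 0) - c)) ^ 2 ≤ g x s ^ 2 * c := by
      intro x
      have e' : ∀ v, ρ v * (g x s * ((if h v = m then 1 else 0) - c)) ^ 2 =
          g x s ^ 2 * ((ρ v * if h v = m then 1 else 0) -
            2 * c * (ρ v * if h v = m then 1 else 0) + ρ v * c ^ 2) := by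
        intro v; split_ifs <;> ring
      simp only [e', ← Finset.mul_sum]
      refine mul_le_mul_of_nonneg_left ?_ (sq_nonneg _)
      rw [Finset.sum_add_distrib, Finset.sum_sub_distrib, ← Finset.mul_sum, ← Finset.sum_mul,
        hh, hρ1]
      nlinarith [sq_nonneg c]
    refine (Finset.sum_le_sum fun x _ => e x).trans ?_
    rw [← Finset.sum_mul]
    calc (∑ x, g x s ^ 2) * c ≤ (∑ x, η * qS s * g x s) * c := by
          refine mul_le_mul_of_nonneg_right (Finset.sum_le_sum fun x _ => ?_) hc0
          rw [sq]
          exact mul_le_mul_of_nonneg_right (hgle x s) (hg0 x s)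
      _ ≤ (η * qS s * qS s) * c := by
          rw [← Finset.mul_sum]
          exact mul_le_mul_of_nonneg_right
            (mul_le_mul_of_nonneg_left (hgs s) (mul_nonneg hη (hqS0 s))) hc0
      _ = _ := by ring
  have habs : ∀ s m, ∑ Φ : X → V, (∏ x, ρ (Φ x)) *
      |∑ x, g x s * ((if h (Φ x) = m then 1 else 0) - c)| ≤ √(η * c) * qS s := by
    intro s m
    set v : (X → V) → ℝ := fun Φ => ∑ x, g x s * ((if h (Φ x) = m then 1 else 0) - c)
    calc ∑ Φ : X → V, (∏ x, ρ (Φ x)) * |v Φ|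
        = ∑ Φ : X → V, √(∏ x, ρ (Φ x)) * √((∏ x, ρ (Φ x)) * v Φ ^ 2) := by
          refine Finset.sum_congr rfl fun Φ _ => ?_
          rw [Real.sqrt_mul (hw Φ), Real.sqrt_sq_eq_abs, ← mul_assoc, Real.mul_self_sqrt (hw Φ)]
      _ ≤ √(∑ Φ : X → V, ∏ x, ρ (Φ x)) * √(∑ Φ : X → V, (∏ x, ρ (Φ x)) * v Φ ^ 2) :=
          Real.sum_sqrt_mul_sqrt_le _ hw fun Φ => mul_nonneg (hw Φ) (sq_nonneg _)
      _ ≤ √(η * c * qS s ^ 2) := by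
          rw [hw1, Real.sqrt_one, one_mul]
          exact Real.sqrt_le_sqrt (hvar s m)
      _ = _ := by rw [Real.sqrt_mul (by positivity), Real.sqrt_sq (hqS0 s)]
  calc _ ≤ ∑ Φ : X → V, (∏ x, ρ (Φ x)) *
        ((∑ s, ∑ m, |∑ x, g x s * ((if h (Φ x) = m then 1 else 0) - c)|) +
          2 * ∑ x, ∑ s, b x s) := by
        refine Finset.sum_le_sum fun Φ _ => mul_le_mul_of_nonneg_left ?_ (hw Φ)
        rw [← hbad Φ]
        simp only [← Finset.sum_add_distrib]
        exact Finset.sum_le_sum fun s _ => Finset.sum_le_sum fun m _ =>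
          hsplit Φ s m
    _ = (∑ s, ∑ m, ∑ Φ : X → V, (∏ x, ρ (Φ x)) *
          |∑ x, g x s * ((if h (Φ x) = m then 1 else 0) - c)|) + 2 * ∑ x, ∑ s, b x s := by
        simp only [mul_add, Finset.sum_add_distrib]
        rw [← Finset.sum_mul, hw1, one_mul]
        congr 1
        simp only [Finset.mul_sum]
        rw [Finset.sum_comm]
        exact Finset.sum_congr rfl fun s _ => Finset.sum_comm
    _ ≤ (∑ s, ∑ _m : M, √(η * c) * qS s) + 2 * ∑ x, ∑ s, b x s :=
        add_le_add_left (Finset.sum_le_sum fun s _ => Finset.sum_le_sum fun m _ => habs s m) _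
    _ ≤ _ := by
        simp only [Finset.sum_const, Finset.card_univ, nsmul_eq_mul]
        rw [← Finset.mul_sum, ← Finset.mul_sum]
        have e : (Fintype.card M : ℝ) * √(η * c) = √(η * Fintype.card M) := by
          rw [← Real.sqrt_sq hMpos.le, ← Real.sqrt_mul (by positivity)]
          congr 1
          rw [Real.sqrt_sq hMpos.le, hc]
          field_simp
        have := mul_le_mul_of_nonneg_left hqS1 (Real.sqrt_nonneg (η * Fintype.card M))
        rw [← e] at this ⊢
        linarith

end Hashing

/-! ### The hashing protocol -/

/-- Replacing the law of `h` in a product form of the target by another one at most doubles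
the distance. -/
theorem sum_abs_sub_mul_law_le {α C : Type} [Fintype α] [Fintype C] (A : α → ℝ) {D : α → ℝ}
    (hD : ∀ w, 0 ≤ D w) (h : α → C) (hD1 : ∀ c, law D h c = 1) (q : C → ℝ) :
    ∑ w, |A w - D w * law A h (h w)| ≤ 2 * ∑ w, |A w - D w * q (h w)| := by
  classical
  have h1 : ∑ w, D w * |q (h w) - law A h (h w)| = ∑ c, |q c - law A h c| := by
    rw [← sum_law_mul D h fun c => |q c - law A h c|]
    simp [hD1]
  have h2 : ∀ c, |q c - law A h c| ≤ ∑ w, if h w = c then |A w - D w * q (h w)| else 0 := by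
    intro c
    have e : q c - law A h c = -∑ w, if h w = c then A w - D w * q (h w) else 0 := by
      have e1 : q c = ∑ w, if h w = c then D w * q (h w) else 0 := by
        calc q c = law D h c * q c := by rw [hD1, one_mul]
          _ = _ := by
            unfold law
            rw [Finset.sum_mul]
            refine Finset.sum_congr rfl fun w _ => ?_
            split_ifs with hw
            · rw [hw]
            · rw [zero_mul]
      have e2 : law A h c = ∑ w, if h w = c then A w else 0 := by unfold law; congr!
      rw [e2, e1, ← Finset.sum_sub_distrib, ← Finset.sum_neg_distrib]
      refine Finset.sum_congr rfl fun w _ => ?_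
      split_ifs with hw
      · rw [hw]; ring
      · ring
    rw [e, abs_neg]
    refine (Finset.abs_sum_le_sum_abs _ _).trans (Finset.sum_le_sum fun w _ => ?_)
    split_ifs <;> simp
  -- Passing to the marginal of `h` does not increase the distance.
  have h3 : ∑ c, |q c - law A h c| ≤ ∑ w, |A w - D w * q (h w)| := by
    refine (Finset.sum_le_sum fun c _ => h2 c).trans_eq ?_
    rw [Finset.sum_comm]
    simp
  have h4 : ∀ w, |A w - D w * law A h (h w)| ≤
      |A w - D w * q (h w)| + D w * |q (h w) - law A h (h w)| := by
    intro w
    have : A w - D w * law A h (h w) =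
        (A w - D w * q (h w)) + D w * (q (h w) - law A h (h w)) := by ring
    rw [this]
    refine (abs_add_le _ _).trans_eq ?_
    rw [abs_mul, abs_of_nonneg (hD w)]
  refine (Finset.sum_le_sum fun w _ => h4 w).trans ?_
  rw [Finset.sum_add_distrib, h1]
  linarith

/-- Bitwise sum of two bit strings. -/
def bitXor {k : ℕ} (g u : Fin k → Bool) : Fin k → Bool := fun j => xor (g j) (u j)

theorem bitXor_eq_iff {k : ℕ} {g u c : Fin k → Bool} : bitXor g u = c ↔ u = bitXor g c := by
  constructor <;> rintro rfl <;> funext j <;> simp [bitXor]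

section HashProtocol

variable {X Y : Type} [Fintype X] [Fintype Y] {a k l : ℕ}

open Classical in
/-- Alice publishes `F x` in clear and `G x` encrypted with the initial key. Bob decodes `x` and
applies the channel `W` to `(x, y)`. The final key is `K x`. -/
noncomputable def hashProtocol (F : X → Fin a → Bool) (G : X → Fin k → Bool)
    (K : X → Fin l → Bool) (dec : Y → (Fin a → Bool) → (Fin k → Bool) → X)
    (W : X × Y → X × Y → ℝ) (hW : ∀ t, W t ∈ stdSimplex ℝ (X × Y)) :
    LOPC (X × (Fin k → Bool)) (Y × (Fin k → Bool)) (Fin l → Bool) (X × Y × (Fin l → Bool)) where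
  RA := Unit
  RB := X × Y → X × Y
  MA := (Fin a → Bool) × (Fin k → Bool)
  MB := Unit
  lawA := fun _ => 1
  lawB := fun r => ∏ t, W t (r t)
  lawA_mem := by simp [stdSimplex]
  lawB_mem := ⟨fun r => Finset.prod_nonneg fun t _ => (hW t).1 _, by
    rw [sum_prod_apply_eq]; exact Finset.prod_eq_one fun t _ => (hW t).2⟩
  rounds := 1
  sendA := fun x _ _ _ => (F x.1, bitXor (G x.1) x.2)
  sendB := fun _ _ _ _ => ()
  outA := fun x _ _ => K x.1
  outB := fun y r c =>
    ((r (dec y.1 (c 0).1.1 (bitXor (c 0).1.2 y.2), y.1)).1,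
      (r (dec y.1 (c 0).1.1 (bitXor (c 0).1.2 y.2), y.1)).2,
      K (dec y.1 (c 0).1.1 (bitXor (c 0).1.2 y.2)))

variable {F : X → Fin a → Bool} {G : X → Fin k → Bool} {K : X → Fin l → Bool}
  {dec : Y → (Fin a → Bool) → (Fin k → Bool) → X} {W : X × Y → X × Y → ℝ}
  {hW : ∀ t, W t ∈ stdSimplex ℝ (X × Y)}

theorem hashProtocol_transcript (x : X × (Fin k → Bool)) (y : Y × (Fin k → Bool)) (ra : Unit)
    (r : X × Y → X × Y) :
    (hashProtocol F G K dec W hW).transcript x y ra r =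
      fun _ => ((F x.1, bitXor (G x.1) x.2), ()) := by
  refine ((hashProtocol F G K dec W hW).history_eq_iff x y ra r _).2 ⟨fun i => rfl, fun i => rfl⟩

open Classical in
/-- The final distribution of the hashing protocol if Bob decodes correctly. -/
theorem law_hashProtocol_correct {S : Type} [Fintype S] {p : X → Y → S → ℝ}
    {V : S → X × Y → ℝ} (hV : ∀ x y s t, p x y s * W (x, y) t = p x y s * V s t)
    (hW : ∀ t, W t ∈ stdSimplex ℝ (X × Y))
    (u : Fin l → Bool) (t : X × Y) (v : Fin l → Bool) (s : S)
    (c : Fin 1 → ((Fin a → Bool) × (Fin k → Bool)) × Unit) :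
    law (fun ω : ((X × (Fin k → Bool)) × (Y × (Fin k → Bool))) × S × Unit × (X × Y → X × Y) =>
        p ω.1.1.1 ω.1.2.1 ω.2.1 * keyLaw ω.1.1.2 ω.1.2.2 * 1 * ∏ t, W t (ω.2.2.2 t))
      (fun ω => (K ω.1.1.1, ((ω.2.2.2 (ω.1.1.1, ω.1.2.1)).1, (ω.2.2.2 (ω.1.1.1, ω.1.2.1)).2,
        K ω.1.1.1), ω.2.1, (fun _ : Fin 1 => ((F ω.1.1.1, bitXor (G ω.1.1.1) ω.1.1.2), ()))))
      (u, (t.1, t.2, v), s, c) =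
    (if u = v then V s t * ((2 : ℝ) ^ k)⁻¹ else 0) *
      ∑ x, (∑ y, p x y s) * if F x = (c 0).1.1 ∧ K x = u then 1 else 0 := by
  have hc : ∀ m : (Fin a → Bool) × (Fin k → Bool),
      (fun _ : Fin 1 => (m, ())) = c ↔ m = (c 0).1 := by
    intro m
    constructor
    · rintro rfl; rfl
    · rintro rfl; funext i; rw [Subsingleton.elim i 0]
  -- The event splits into conditions on the pad `w`, on `s'`, on `x` and on the coins `r`, so the
  -- sums can be carried out one after another. For given `x` and `c` exactly one pad fits.
  have hstep : ∀ (x : X) (w : Fin k → Bool) (y : Y) (w' : Fin k → Bool) (s' : S)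
      (r : X × Y → X × Y),
      (if (K x, ((r (x, y)).1, (r (x, y)).2, K x), s',
          (fun _ : Fin 1 => ((F x, bitXor (G x) w), ()))) = (u, (t.1, t.2, v), s, c) then
        p x y s' * keyLaw w w' * 1 * ∏ t, W t (r t) else 0) =
      (if w = bitXor (G x) (c 0).1.2 then 1 else 0) *
        (keyLaw w w' * ((if s' = s then
          (if u = v then (if F x = (c 0).1.1 ∧ K x = u then 1 else 0) else 0) * p x y s' else 0) *
          ((∏ t, W t (r t)) * if r (x, y) = t then 1 else 0))) := by
    intro x w y w' s' r
    have hcond : (K x, ((r (x, y)).1, (r (x, y)).2, K x), s',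
          (fun _ : Fin 1 => ((F x, bitXor (G x) w), ()))) = (u, (t.1, t.2, v), s, c) ↔
        (w = bitXor (G x) (c 0).1.2 ∧ s' = s ∧ u = v ∧ (F x = (c 0).1.1 ∧ K x = u) ∧
          r (x, y) = t) := by
      simp only [Prod.mk.injEq, hc]
      rw [Prod.ext_iff (x := r (x, y)), Prod.ext_iff (y := (c 0).1), bitXor_eq_iff]
      constructor
      · rintro ⟨h1, ⟨h2, h3, h4⟩, h5, h6, h7⟩
        exact ⟨h7, h5, h1.symm.trans h4, ⟨h6, h1⟩, h2, h3⟩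
      · rintro ⟨h7, h5, h4, ⟨h6, h1⟩, h2, h3⟩
        exact ⟨h1, ⟨h2, h3, h1.trans h4⟩, h5, h6, h7⟩
    by_cases h1 : w = bitXor (G x) (c 0).1.2
    · by_cases h2 : s' = s
      · by_cases h3 : u = v
        · by_cases h4 : F x = (c 0).1.1 ∧ K x = u
          · by_cases h5 : r (x, y) = t
            · rw [if_pos (hcond.2 ⟨h1, h2, h3, h4, h5⟩)]
              simp only [if_pos h1, if_pos h2, if_pos h3, if_pos h4, if_pos h5]
              ring
            · rw [if_neg fun h => h5 (hcond.1 h).2.2.2.2]; simp [h5]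
          · rw [if_neg fun h => h4 (hcond.1 h).2.2.2.1]; simp only [if_neg h4]; simp
        · rw [if_neg fun h => h3 (hcond.1 h).2.2.1]; simp [h3]
      · rw [if_neg fun h => h2 (hcond.1 h).2.1]; simp [h2]
    · rw [if_neg fun h => h1 (hcond.1 h).1]; simp [h1]
  have hr : ∀ x y, ∑ r : X × Y → X × Y, (∏ t, W t (r t)) * (if r (x, y) = t then (1 : ℝ) else 0) =
      W (x, y) t := fun x y => by
    rw [sum_prod_mul_apply (fun t => (hW t).2) (x, y) fun t' => if t' = t then (1 : ℝ) else 0]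
    simp
  unfold law
  simp only [Fintype.sum_prod_type, Fintype.sum_unique]
  simp only [hstep, ← Finset.mul_sum, hr]
  simp only [ite_mul, zero_mul, one_mul, Finset.sum_ite_eq', Finset.mem_univ,
    if_true, ← Finset.sum_mul, sum_keyLaw_right]
  by_cases huv : u = v
  · simp only [if_pos huv, Finset.mul_sum]
    refine Finset.sum_congr rfl fun x _ => ?_
    split_ifs
    · rw [mul_one, Finset.mul_sum]
      refine Finset.sum_congr rfl fun y _ => ?_
      -- Here resampling from `(x, y)` becomes sampling from `s`, which decouples the output from
      -- `x`.
      rw [hV]; ring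
    · simp
  · simp [huv]

-- Apart from decoding failures, the run is a resampled pair that depends on `s` alone, next to a
-- transcript and a key computed from `x`. The error is thus controlled by the decoding error and by
-- the distance of `(F, K)` from uniform given `s`.
open Classical in
theorem hashProtocol_error_le {S : Type} [Fintype S] {p : X → Y → S → ℝ}
    (hp : ∀ x y s, 0 ≤ p x y s) (hp1 : ∑ x, ∑ y, ∑ s, p x y s = 1) {V : S → X × Y → ℝ}
    (hV : ∀ x y s t, p x y s * W (x, y) t = p x y s * V s t) (hV0 : ∀ s t, 0 ≤ V s t)
    (hV1 : ∀ s, ∑ t, V s t ≤ 1)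
    (hpV : ∀ s t, p t.1 t.2 s = V s t * ∑ x, ∑ y, p x y s)
    (hW : ∀ t, W t ∈ stdSimplex ℝ (X × Y)) :
    ∑ w : (Fin l → Bool) × (X × Y × (Fin l → Bool)) × S ×
        (hashProtocol F G K dec W hW).Transcript,
      |(hashProtocol F G K dec W hW).apply (fun a b s => p a.1 b.1 s * keyLaw a.2 b.2)
          w.1 w.2.1 w.2.2.1 w.2.2.2 -
        p w.2.1.1 w.2.1.2.1 w.2.2.1 * keyLaw w.1 w.2.1.2.2 *
          law (fun w : (Fin l → Bool) × (X × Y × (Fin l → Bool)) × S ×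
              (hashProtocol F G K dec W hW).Transcript =>
            (hashProtocol F G K dec W hW).apply (fun a b s => p a.1 b.1 s * keyLaw a.2 b.2)
              w.1 w.2.1 w.2.2.1 w.2.2.2) (fun w => w.2.2.2) w.2.2.2| ≤
      2 * (2 * (∑ x, ∑ y, ∑ s, if dec y (F x) (G x) = x then 0 else p x y s) +
        ∑ s, ∑ m : (Fin a → Bool) × (Fin l → Bool),
          |(∑ x, (∑ y, p x y s) * if (F x, K x) = m then 1 else 0) -
            (∑ x, ∑ y, p x y s) * (Fintype.card ((Fin a → Bool) × (Fin l → Bool)) : ℝ)⁻¹|) := by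
  set π := hashProtocol F G K dec W hW with hπ
  set A : (Fin l → Bool) × (X × Y × (Fin l → Bool)) × S × π.Transcript → ℝ := fun w =>
    π.apply (fun a b s => p a.1 b.1 s * keyLaw a.2 b.2) w.1 w.2.1 w.2.2.1 w.2.2.2 with hA
  set D : (Fin l → Bool) × (X × Y × (Fin l → Bool)) × S × π.Transcript → ℝ := fun w =>
    p w.2.1.1 w.2.1.2.1 w.2.2.1 * keyLaw w.1 w.2.1.2.2 with hD
  have hD0 : ∀ w, 0 ≤ D w := fun w => mul_nonneg (hp _ _ _) (keyLaw_nonneg _ _)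
  have hD1 : ∀ c, law D (fun w => w.2.2.2) c = 1 := by
    intro c
    rw [← hp1, ← sum_mul_keyLaw_final (m := l) p]
    unfold law
    simp only [Fintype.sum_prod_type, hD]
    refine Finset.sum_congr rfl fun u _ => Finset.sum_congr rfl fun x _ =>
      Finset.sum_congr rfl fun y _ => Finset.sum_congr rfl fun v _ =>
      Finset.sum_congr rfl fun s _ => ?_
    exact Fintype.sum_ite_eq' c fun _ => p x y s * keyLaw u v
  -- The ideal distribution contains the actual law of the transcript. Comparing with a uniform
  -- transcript instead costs the outer factor 2.
  refine (sum_abs_sub_mul_law_le A hD0 (fun w => w.2.2.2) hD1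
    fun _ => ((2 : ℝ) ^ a)⁻¹ * ((2 : ℝ) ^ k)⁻¹).trans ?_
  refine mul_le_mul_of_nonneg_left ?_ (by norm_num)
  set wt : ((X × (Fin k → Bool)) × (Y × (Fin k → Bool))) × S × Unit × (X × Y → X × Y) → ℝ :=
    fun ω => p ω.1.1.1 ω.1.2.1 ω.2.1 * keyLaw ω.1.1.2 ω.1.2.2 * 1 * ∏ t, W t (ω.2.2.2 t) with hwt
  set tr : ((X × (Fin k → Bool)) × (Y × (Fin k → Bool))) × S × Unit × (X × Y → X × Y) →
      π.Transcript := fun ω _ => ((F ω.1.1.1, bitXor (G ω.1.1.1) ω.1.1.2), ()) with htr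
  set f : ((X × (Fin k → Bool)) × (Y × (Fin k → Bool))) × S × Unit × (X × Y → X × Y) →
      (Fin l → Bool) × (X × Y × (Fin l → Bool)) × S × π.Transcript := fun ω =>
    (π.outA ω.1.1 ω.2.2.1 (tr ω), π.outB ω.1.2 ω.2.2.2 (tr ω), ω.2.1, tr ω) with hf
  set g : ((X × (Fin k → Bool)) × (Y × (Fin k → Bool))) × S × Unit × (X × Y → X × Y) →
      (Fin l → Bool) × (X × Y × (Fin l → Bool)) × S × π.Transcript := fun ω =>
    (K ω.1.1.1, ((ω.2.2.2 (ω.1.1.1, ω.1.2.1)).1, (ω.2.2.2 (ω.1.1.1, ω.1.2.1)).2,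
        K ω.1.1.1), ω.2.1, tr ω) with hg
  have hAf : A = law wt f := by
    have htr' : ∀ ω : ((X × (Fin k → Bool)) × (Y × (Fin k → Bool))) × S × Unit × (X × Y → X × Y),
        π.transcript ω.1.1 ω.1.2 ω.2.2.1 ω.2.2.2 = tr ω := fun ω =>
      hashProtocol_transcript _ _ _ _
    have hfe : f = fun ω => (π.outA ω.1.1 ω.2.2.1 (π.transcript ω.1.1 ω.1.2 ω.2.2.1 ω.2.2.2),
        π.outB ω.1.2 ω.2.2.2 (π.transcript ω.1.1 ω.1.2 ω.2.2.1 ω.2.2.2), ω.2.1,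
        π.transcript ω.1.1 ω.1.2 ω.2.2.1 ω.2.2.2) := funext fun ω => by rw [htr']
    rw [hfe]
    exact π.apply_eq_law _
  have hwt0 : ∀ ω, 0 ≤ wt ω := fun ω => mul_nonneg (mul_nonneg
    (mul_nonneg (hp _ _ _) (keyLaw_nonneg _ _)) zero_le_one)
    (Finset.prod_nonneg fun t _ => (hW t).1 _)
  -- The run `g` uses the true `x` in place of the decoded one. The runs can differ only if decoding
  -- fails or the key halves disagree, and the latter has probability zero.
  have hAg := sum_abs_law_sub_law_le hwt0 f g
    (fun ω => ¬(ω.1.1.2 = ω.1.2.2 ∧ dec ω.1.2.1 (F ω.1.1.1) (G ω.1.1.1) = ω.1.1.1)) (by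
      intro ω hω
      rw [not_not] at hω
      obtain ⟨h1, h2⟩ := hω
      have h3 : bitXor (bitXor (G ω.1.1.1) ω.1.1.2) ω.1.2.2 = G ω.1.1.1 := by
        rw [← h1]; funext j; simp [bitXor]
      have h4 : f ω = (K ω.1.1.1,
          ((ω.2.2.2 (dec ω.1.2.1 (F ω.1.1.1) (bitXor (bitXor (G ω.1.1.1) ω.1.1.2) ω.1.2.2),
            ω.1.2.1)).1,
          (ω.2.2.2 (dec ω.1.2.1 (F ω.1.1.1) (bitXor (bitXor (G ω.1.1.1) ω.1.1.2) ω.1.2.2),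
            ω.1.2.1)).2,
          K (dec ω.1.2.1 (F ω.1.1.1) (bitXor (bitXor (G ω.1.1.1) ω.1.1.2) ω.1.2.2))),
          ω.2.1, tr ω) := rfl
      rw [h4, h3, h2])
  have hbad : (∑ ω, if ¬(ω.1.1.2 = ω.1.2.2 ∧ dec ω.1.2.1 (F ω.1.1.1) (G ω.1.1.1) = ω.1.1.1) then
      wt ω else 0) = ∑ x, ∑ y, ∑ s, if dec y (F x) (G x) = x then 0 else p x y s := by
    have e : ∀ ω, (if ¬(ω.1.1.2 = ω.1.2.2 ∧ dec ω.1.2.1 (F ω.1.1.1) (G ω.1.1.1) = ω.1.1.1) then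
        wt ω else 0) = (if dec ω.1.2.1 (F ω.1.1.1) (G ω.1.1.1) = ω.1.1.1 then 0 else
          p ω.1.1.1 ω.1.2.1 ω.2.1) * keyLaw ω.1.1.2 ω.1.2.2 * ∏ t, W t (ω.2.2.2 t) := by
      intro ω
      by_cases h2 : dec ω.1.2.1 (F ω.1.1.1) (G ω.1.1.1) = ω.1.1.1
      · by_cases h1 : ω.1.1.2 = ω.1.2.2
        · simp [h1, h2]
        · simp [h1, h2, hwt, keyLaw_eq]
      · simp [h2, hwt]
    have hr : ∑ r : X × Y → X × Y, ∏ t, W t (r t) = 1 := by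
      rw [sum_prod_apply_eq]; exact Finset.prod_eq_one fun t _ => (hW t).2
    rw [← sum_mul_keyLaw_initial (m := k)]
    simp only [e, Fintype.sum_prod_type, Fintype.sum_unique, ← Finset.mul_sum, hr, mul_one]
  rw [hbad] at hAg
  -- The channel `V s` factors out with mass at most one, and the padded message contributes the
  -- uniform factor, so only the pair `(F, K)` is left to compare with uniform.
  have hgD : ∑ w, |law wt g w - D w * (((2 : ℝ) ^ a)⁻¹ * ((2 : ℝ) ^ k)⁻¹)| ≤
      ∑ s, ∑ m : (Fin a → Bool) × (Fin l → Bool),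
          |(∑ x, (∑ y, p x y s) * if (F x, K x) = m then 1 else 0) -
            (∑ x, ∑ y, p x y s) * (Fintype.card ((Fin a → Bool) × (Fin l → Bool)) : ℝ)⁻¹| := by
    set T : S → (Fin a → Bool) → (Fin l → Bool) → ℝ := fun s c u =>
      |(∑ x, (∑ y, p x y s) * if (F x, K x) = (c, u) then 1 else 0) -
        (∑ x, ∑ y, p x y s) * (Fintype.card ((Fin a → Bool) × (Fin l → Bool)) : ℝ)⁻¹| with hT
    set first : π.Transcript → (Fin a → Bool) × (Fin k → Bool) :=
      fun (c : Fin 1 → ((Fin a → Bool) × (Fin k → Bool)) × Unit) => (c 0).1 with hfirst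
    have e : ∀ (u : Fin l → Bool) (x : X) (y : Y) (v : Fin l → Bool) (s : S) (c : π.Transcript),
        |law wt g (u, (x, y, v), s, c) - D (u, (x, y, v), s, c) *
          (((2 : ℝ) ^ a)⁻¹ * ((2 : ℝ) ^ k)⁻¹)| =
        (if u = v then V s (x, y) * (((2 : ℝ) ^ k)⁻¹ * T s (first c).1 u) else 0) := by
      intro u x y v s c
      have h1 := law_hashProtocol_correct (F := F) (G := G) (K := K) hV hW u (x, y) v s c
      have h2 : law wt g (u, (x, y, v), s, c) = _ := h1
      rw [h2]
      simp only [hD, keyLaw_eq]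
      by_cases huv : u = v
      · rw [if_pos huv, if_pos huv, if_pos huv, hpV s (x, y)]
        have h3 : 0 ≤ V s (x, y) * ((2 : ℝ) ^ k)⁻¹ := mul_nonneg (hV0 _ _) (by positivity)
        rw [← mul_assoc (V s (x, y)), ← abs_of_nonneg h3, hT, ← abs_mul, abs_of_nonneg h3]
        congr 1
        simp only [Prod.mk.injEq, Fintype.card_prod, Fintype.card_fun, Fintype.card_bool,
          Fintype.card_fin]
        push_cast
        rw [mul_inv]
        simp only [hfirst]
        ring
      · simp [huv]
    let eqv : π.Transcript ≃ (Fin a → Bool) × (Fin k → Bool) :=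
      (Equiv.funUnique (Fin 1) (((Fin a → Bool) × (Fin k → Bool)) × Unit)).trans
        (Equiv.prodPUnit ((Fin a → Bool) × (Fin k → Bool)))
    have hsum : ∀ s u, ∑ c : π.Transcript, ((2 : ℝ) ^ k)⁻¹ * T s (first c).1 u =
        ∑ m, T s m u := by
      intro s u
      refine (Fintype.sum_equiv eqv (fun c => ((2 : ℝ) ^ k)⁻¹ * T s (first c).1 u)
        (fun m => ((2 : ℝ) ^ k)⁻¹ * T s m.1 u) fun c => rfl).trans ?_
      simp only [Fintype.sum_prod_type, ← Finset.sum_mul, sum_const_inv_two_pow, one_mul]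
    have hT0 : ∀ s u, 0 ≤ ∑ m, T s m u := fun s u => Finset.sum_nonneg fun m _ => abs_nonneg _
    have e2 : ∀ (u : Fin l → Bool) (x : X) (y : Y) (v : Fin l → Bool) (s : S),
        ∑ c : π.Transcript, (if u = v then V s (x, y) * (((2 : ℝ) ^ k)⁻¹ * T s (first c).1 u)
          else 0) = if u = v then V s (x, y) * ∑ m, T s m u else 0 := by
      intro u x y v s
      split_ifs
      · rw [← Finset.mul_sum, hsum]
      · simp
    simp only [Fintype.sum_prod_type, e, e2]
    calc _ = ∑ u : Fin l → Bool, ∑ t : X × Y, ∑ s, V s t * ∑ m, T s m u := by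
          simp only [Fintype.sum_prod_type]
          refine Finset.sum_congr rfl fun u _ => Finset.sum_congr rfl fun x _ =>
            Finset.sum_congr rfl fun y _ => ?_
          rw [Finset.sum_comm]
          simp
      _ ≤ ∑ u : Fin l → Bool, ∑ s, ∑ m, T s m u := by
          refine Finset.sum_le_sum fun u _ => ?_
          rw [Finset.sum_comm]
          refine Finset.sum_le_sum fun s _ => ?_
          rw [← Finset.sum_mul]
          exact mul_le_of_le_one_left (hT0 s u) (hV1 s)
      _ = _ := by
          rw [Finset.sum_comm]
          exact Finset.sum_congr rfl fun s _ => Finset.sum_comm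
  have htri : ∀ w, |A w - D w * (((2 : ℝ) ^ a)⁻¹ * ((2 : ℝ) ^ k)⁻¹)| ≤
      |law wt f w - law wt g w| + |law wt g w - D w * (((2 : ℝ) ^ a)⁻¹ * ((2 : ℝ) ^ k)⁻¹)| := by
    intro w
    rw [hAf]
    exact abs_sub_le _ _ _
  refine (Finset.sum_le_sum fun w _ => htri w).trans ?_
  rw [Finset.sum_add_distrib]
  exact add_le_add hAg hgD

end HashProtocol

/-! ### One-shot merging -/

open Classical in
/-- A random hash function can be decoded with the side information `y`, and has nearly uniform
values that are nearly independent of the side information `s`. -/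
theorem exists_hash {X Y S : Type} [Fintype X] [Fintype Y] [Fintype S] (a k l : ℕ)
    {p : X → Y → S → ℝ} (hp : ∀ x y s, 0 ≤ p x y s) (hp1 : ∑ x, ∑ y, ∑ s, p x y s = 1)
    (good : X → Y → Prop) {N : ℝ} (hN : ∀ y, (∑ x, if good x y then (1 : ℝ) else 0) ≤ N)
    (good' : X → S → Prop) {η : ℝ} (hη : 0 ≤ η)
    (hgood' : ∀ x s, good' x s → ∑ y, p x y s ≤ η * ∑ x, ∑ y, p x y s) {ε : ℝ} (hε0 : 0 ≤ ε)
    (hε : a + l = 0 ∨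
      2 * (∑ x, ∑ s, if good' x s then 0 else ∑ y, p x y s) + √(η * 2 ^ (a + l)) ≤ ε) :
    ∃ (F : X → Fin a → Bool) (G : X → Fin k → Bool) (K : X → Fin l → Bool)
      (dec : Y → (Fin a → Bool) → (Fin k → Bool) → X),
      2 * (∑ x, ∑ y, ∑ s, if dec y (F x) (G x) = x then 0 else p x y s) +
        ∑ s, ∑ m : (Fin a → Bool) × (Fin l → Bool),
          |(∑ x, (∑ y, p x y s) * if (F x, K x) = m then 1 else 0) -
            (∑ x, ∑ y, p x y s) * (Fintype.card ((Fin a → Bool) × (Fin l → Bool)) : ℝ)⁻¹| ≤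
      2 * ((∑ x, ∑ y, if good x y then 0 else ∑ s, p x y s) + N * (2 ^ (a + k))⁻¹) + ε := by
  have hX : Nonempty X := by
    by_contra h
    rw [not_nonempty_iff] at h
    simp at hp1
  -- One uniform value carries all three hashes. Decoding uses the first two components, extraction
  -- the first and the third.
  let V := (Fin a → Bool) × (Fin k → Bool) × (Fin l → Bool)
  let ρ : V → ℝ := fun _ => (Fintype.card V : ℝ)⁻¹
  have hV : (0 : ℝ) < Fintype.card V := by exact_mod_cast Fintype.card_pos
  have hρ : ∀ v, 0 ≤ ρ v := fun v => inv_nonneg.2 hV.le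
  have hρ1 : ∑ v, ρ v = 1 := by simp [ρ, hV.ne']
  let h₁ : V → (Fin a → Bool) × (Fin k → Bool) := fun v => (v.1, v.2.1)
  let h₂ : V → (Fin a → Bool) × (Fin l → Bool) := fun v => (v.1, v.2.2)
  have hh₁ : ∀ m, (∑ v, ρ v * if h₁ v = m then 1 else 0) =
      (Fintype.card ((Fin a → Bool) × (Fin k → Bool)) : ℝ)⁻¹ := by
    rintro ⟨m, m'⟩
    simp only [ρ, h₁, V, Fintype.sum_prod_type, Prod.mk.injEq, ite_and, ← Finset.mul_sum]
    simp
    field_simp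
    rw [Finset.sum_eq_single m' (fun x _ hx => by simp [hx]) (by simp)]
    simp
  have hh₂ : ∀ m, (∑ v, ρ v * if h₂ v = m then 1 else 0) =
      (Fintype.card ((Fin a → Bool) × (Fin l → Bool)) : ℝ)⁻¹ := by
    rintro ⟨m, m'⟩
    simp only [ρ, h₂, V, Fintype.sum_prod_type, Prod.mk.injEq, ite_and, ← Finset.mul_sum]
    simp
    field_simp
  have hw : ∀ Φ : X → V, 0 < ∏ x, ρ (Φ x) := fun Φ => Finset.prod_pos fun _ _ => inv_pos.2 hV
  have hw1 : ∑ Φ : X → V, ∏ x, ρ (Φ x) = 1 := by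
    rw [sum_prod_apply_eq fun _ v => ρ v]; simp [hρ1]
  have hq1 : ∑ s, ∑ x, ∑ y, p x y s = 1 := by
    rw [← hp1, Finset.sum_comm]
    exact Finset.sum_congr rfl fun x _ => Finset.sum_comm
  have hcoll := sum_prod_mul_collision_le hρ hρ1 hh₁ Fintype.card_ne_zero
    (q := fun x y => ∑ s, p x y s) (fun x y => Finset.sum_nonneg fun s _ => hp x y s) good hN
  rw [hp1, one_mul] at hcoll
  have hext : (∑ Φ : X → V, (∏ x, ρ (Φ x)) * ∑ s, ∑ m,
      |(∑ x, (∑ y, p x y s) * if h₂ (Φ x) = m then 1 else 0) - (∑ x, ∑ y, p x y s) *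
        (Fintype.card ((Fin a → Bool) × (Fin l → Bool)) : ℝ)⁻¹|) ≤ ε := by
    rcases hε with h0 | hε
    · obtain ⟨rfl, rfl⟩ : a = 0 ∧ l = 0 := by omega
      refine le_trans (le_of_eq ?_) hε0
      refine Finset.sum_eq_zero fun Φ _ => mul_eq_zero_of_right _ ?_
      refine Finset.sum_eq_zero fun s _ => Finset.sum_eq_zero fun m _ => ?_
      have : ∀ x, h₂ (Φ x) = m := fun x => Subsingleton.elim _ _
      simp [this]
    · refine le_trans (sum_prod_mul_sum_abs_sub_le hρ hρ1 hh₂ Fintype.card_ne_zero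
        (q := fun x s => ∑ y, p x y s) (fun x s => Finset.sum_nonneg fun y _ => hp x y s)
        (qS := fun s => ∑ x, ∑ y, p x y s) (fun s => rfl) hq1.le good' hη hgood') ?_
      refine le_of_eq_of_le ?_ hε
      simp [pow_add]
  let coll : (X → V) → ℝ := fun Φ => ∑ x, ∑ y,
    if ∃ x', x' ≠ x ∧ good x' y ∧ h₁ (Φ x') = h₁ (Φ x) then ∑ s, p x y s else 0
  let ext : (X → V) → ℝ := fun Φ => ∑ s, ∑ m,
    |(∑ x, (∑ y, p x y s) * if h₂ (Φ x) = m then 1 else 0) - (∑ x, ∑ y, p x y s) *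
        (Fintype.card ((Fin a → Bool) × (Fin l → Bool)) : ℝ)⁻¹|
  -- A single hash function must serve both purposes, so the average is taken of the weighted sum of
  -- the two errors.
  obtain ⟨Φ, -, hΦ⟩ : ∃ Φ ∈ (Finset.univ : Finset (X → V)),
      (∏ x, ρ (Φ x)) * (2 * coll Φ + ext Φ) ≤
        (∏ x, ρ (Φ x)) * (2 * (N * (2 ^ (a + k))⁻¹) + ε) := by
    refine Finset.exists_le_of_sum_le ⟨fun _ => (fun _ => true, fun _ => true, fun _ => true),
      Finset.mem_univ _⟩ ?_
    rw [← Finset.sum_mul, hw1, one_mul]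
    simp only [mul_add, Finset.sum_add_distrib, mul_left_comm _ (2 : ℝ), ← Finset.mul_sum]
    refine add_le_add (mul_le_mul_of_nonneg_left (hcoll.trans_eq ?_) (by norm_num)) hext
    simp [pow_add]
  replace hΦ := le_of_mul_le_mul_left hΦ (hw Φ)
  -- Bob picks any good candidate with the right hash values. This fails only if the true `x` is not
  -- good or a different good candidate collides with it.
  refine ⟨fun x => (Φ x).1, fun x => (Φ x).2.1, fun x => (Φ x).2.2, fun y f g =>
    if h : ∃ x, good x y ∧ (Φ x).1 = f ∧ (Φ x).2.1 = g then h.choose else hX.some, ?_⟩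
  have hdec : (∑ x, ∑ y, ∑ s, if (if h : ∃ x', good x' y ∧ (Φ x').1 = (Φ x).1 ∧
      (Φ x').2.1 = (Φ x).2.1 then h.choose else hX.some) = x then 0 else p x y s) ≤
      (∑ x, ∑ y, if good x y then 0 else ∑ s, p x y s) + coll Φ := by
    simp only [coll, ← Finset.sum_add_distrib]
    refine Finset.sum_le_sum fun x _ => Finset.sum_le_sum fun y _ => ?_
    have h0 : 0 ≤ ∑ s, p x y s := Finset.sum_nonneg fun s _ => hp x y s
    have hr : 0 ≤ (if good x y then 0 else ∑ s, p x y s) +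
        if ∃ x', x' ≠ x ∧ good x' y ∧ h₁ (Φ x') = h₁ (Φ x) then ∑ s, p x y s else 0 := by
      refine add_nonneg ?_ ?_ <;> split_ifs <;> simp [h0]
    by_cases hd : (if h : ∃ x', good x' y ∧ (Φ x').1 = (Φ x).1 ∧
      (Φ x').2.1 = (Φ x).2.1 then h.choose else hX.some) = x
    · simpa only [if_pos hd, Finset.sum_const_zero] using hr
    · simp only [if_neg hd]
      by_cases hg : good x y
      · have hex : ∃ x', good x' y ∧ (Φ x').1 = (Φ x).1 ∧ (Φ x').2.1 = (Φ x).2.1 :=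
          ⟨x, hg, rfl, rfl⟩
        rw [dif_pos hex] at hd
        obtain ⟨c1, c2, c3⟩ := hex.choose_spec
        rw [if_pos hg, zero_add, if_pos ⟨_, hd, c1, Prod.ext c2 c3⟩]
      · rw [if_neg hg]
        refine le_add_of_nonneg_right ?_
        split_ifs <;> simp [h0]
  have := mul_le_mul_of_nonneg_left hdec (zero_le_two (α := ℝ))
  have hext' : ext Φ = ∑ s, ∑ m : (Fin a → Bool) × (Fin l → Bool),
      |(∑ x, (∑ y, p x y s) * if ((Φ x).1, (Φ x).2.2) = m then 1 else 0) -
        (∑ x, ∑ y, p x y s) * (Fintype.card ((Fin a → Bool) × (Fin l → Bool)) : ℝ)⁻¹| := by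
    rfl
  rw [← hext']
  linarith

/-! ### Bi-disjoint distributions -/

section BiDisjoint

variable {X Y Z E : Type} [Fintype X] [Fintype Y] [Fintype Z] [Fintype E]
  {P : X × Y × Z × E → ℝ}

open Classical in
/-- For a bi-disjoint distribution, the conditional law of `(x, y)` given `z` is a function of
the value of `(x, y)`. -/
theorem IsBiDisjoint.exists_channel {T Z : Type} [Fintype T] [Fintype Z] {Q : T × Z → ℝ}
    (h : IsBiDisjoint Q) :
    ∃ (W : T → T → ℝ) (V : Z → T → ℝ), (∀ t, W t ∈ stdSimplex ℝ T) ∧ (∀ z t, 0 ≤ V z t) ∧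
      (∀ z, ∑ t, V z t ≤ 1) ∧ (∀ t z t', Q (t, z) ≠ 0 → W t t' = V z t') ∧
      ∀ z t, Q (t, z) = V z t * ∑ t', Q (t', z) := by
  obtain ⟨m, p, PT, PZ, hp, hT, hZ, hQ, hdT, hdZ⟩ := h
  have uT : ∀ {i j t}, PT i t ≠ 0 → PT j t ≠ 0 → i = j := fun {i j t} h1 h2 => by
    by_contra hij
    exact (mul_ne_zero h1 h2) (hdT i j hij t)
  have uZ : ∀ {i j z}, PZ i z ≠ 0 → PZ j z ≠ 0 → i = j := fun {i j z} h1 h2 => by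
    by_contra hij
    exact (mul_ne_zero h1 h2) (hdZ i j hij z)
  -- `W` and `V` return the component `PT i` of the index read off from `t` or from `z`; disjoint
  -- supports make the index unique. Outside all supports a point mass keeps `W` stochastic, while
  -- `V` may vanish, as only mass at most one is claimed for it.
  refine ⟨fun t => if h : ∃ i, PT i t ≠ 0 then PT h.choose else Pi.single t 1,
    fun z => if h : ∃ i, PZ i z ≠ 0 then PT h.choose else 0, ?_, ?_, ?_, ?_, ?_⟩
  · intro t
    dsimp only
    split_ifs with h
    · exact hT _
    · exact single_mem_stdSimplex ℝ t
  · intro z t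
    dsimp only
    split_ifs with h
    · exact (hT _).1 t
    · exact le_rfl
  · intro z
    dsimp only
    split_ifs with h
    · exact (hT _).2.le
    · simp
  · intro t z t' h0
    rw [hQ] at h0
    obtain ⟨i, -, hi⟩ := Finset.exists_ne_zero_of_sum_ne_zero h0
    have h1 : PT i t ≠ 0 := right_ne_zero_of_mul (left_ne_zero_of_mul hi)
    have h2 : PZ i z ≠ 0 := right_ne_zero_of_mul hi
    have e1 : ∃ i, PT i t ≠ 0 := ⟨i, h1⟩
    have e2 : ∃ i, PZ i z ≠ 0 := ⟨i, h2⟩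
    dsimp only
    rw [dif_pos e1, dif_pos e2, uT e1.choose_spec h1, uZ e2.choose_spec h2]
  · intro z t
    dsimp only
    split_ifs with h
    · have hone : ∀ t, Q (t, z) = p h.choose * PT h.choose t * PZ h.choose z := fun t => by
        rw [hQ, Finset.sum_eq_single h.choose]
        · intro i _ hi
          have : PZ i z = 0 := by
            by_contra h2
            exact hi (uZ h2 h.choose_spec)
          rw [this, mul_zero]
        · simp
      simp only [hone, ← Finset.sum_mul, ← Finset.mul_sum, (hT _).2]
      ring
    · rw [Pi.zero_apply, zero_mul, hQ]
      refine Finset.sum_eq_zero fun i _ => ?_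
      have : PZ i z = 0 := by
        by_contra h2
        exact h ⟨i, h2⟩
      rw [this, mul_zero]

/-- By privacy `e` enters only through the factor `P(e)`, so the channel for `XY` and `Z` also
serves in the presence of `E`. -/
theorem exists_channel_of_isPrivate (hprivate : IsPrivate P) (hbi : IsBiDisjoint (lawTZ P)) :
    ∃ (W : X × Y → X × Y → ℝ) (V : Z → X × Y → ℝ), (∀ t, W t ∈ stdSimplex ℝ (X × Y)) ∧
      (∀ z t, 0 ≤ V z t) ∧ (∀ z, ∑ t, V z t ≤ 1) ∧
      (∀ x y z e t, P (x, y, z, e) * W (x, y) t = P (x, y, z, e) * V z t) ∧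
      ∀ z e t, P (t.1, t.2, z, e) = V z t * law P (fun w => w.2.2) (z, e) := by
  classical
  obtain ⟨W, V, hW, hV0, hV1, hWV, hV⟩ := hbi.exists_channel
  have hQ : ∀ x y z, law P (fun w => (w.1, w.2.1, w.2.2.1)) (x, y, z) =
      lawTZ P ((x, y), z) := fun x y z => by
    simp only [lawTZ, law, Prod.mk.injEq, and_assoc]
  have hPQ : ∀ x y z e, P (x, y, z, e) = lawTZ P ((x, y), z) * law P (fun w => w.2.2.2) e :=
    fun x y z e => by rw [← hQ]; exact hprivate x y z e
  refine ⟨W, V, hW, hV0, hV1, ?_, ?_⟩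
  · intro x y z e t
    by_cases h0 : P (x, y, z, e) = 0
    · rw [h0, zero_mul, zero_mul]
    · rw [hPQ] at h0
      rw [hWV (x, y) z t (left_ne_zero_of_mul h0)]
  · rintro z e ⟨x, y⟩
    have hS : law P (fun w => w.2.2) (z, e) =
        (∑ t', lawTZ P (t', z)) * law P (fun w => w.2.2.2) e := by
      rw [law_S]
      simp only [hPQ, Fintype.sum_prod_type, ← Finset.sum_mul]
    rw [hS, hPQ, hV z (x, y)]
    ring

end BiDisjoint

/-! ### Achievability -/

section Direct

variable {X Y Z E : Type} [Fintype X] [Fintype Y] [Fintype Z] [Fintype E]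
  {P : X × Y × Z × E → ℝ}

-- The resampling channel for sequences acts on each coordinate separately; with it, `exists_hash`
-- supplies the data for `hashProtocol`.
open Classical in
theorem exists_mergingProtocol_error_le (hP : P ∈ stdSimplex ℝ (X × Y × Z × E))
    (hprivate : IsPrivate P) (hbi : IsBiDisjoint (lawTZ P)) (n a k l : ℕ)
    (good : (Fin n → X) → (Fin n → Y) → Prop) {N : ℝ}
    (hN : ∀ y, (∑ x, if good x y then (1 : ℝ) else 0) ≤ N)
    (good' : (Fin n → X) → (Fin n → Z) → (Fin n → E) → Prop) {η : ℝ} (hη : 0 ≤ η)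
    (hgood' : ∀ x z e, good' x z e → ∏ i, law P (fun w => (w.1, w.2.2)) (x i, z i, e i) ≤
      η * ∏ i, law P (fun w => w.2.2) (z i, e i)) {ε : ℝ} (hε0 : 0 ≤ ε)
    (hε : a + l = 0 ∨ 2 * (∑ x, ∑ y, ∑ z, ∑ e, if good' x z e then 0 else iidLaw P x y z e) +
      √(η * 2 ^ (a + l)) ≤ ε) :
    ∃ π : MergingProtocol X Y n k l, π.error P ≤
      2 * (2 * ((∑ x, ∑ y, ∑ z, ∑ e, if good x y then 0 else iidLaw P x y z e) +
        N * (2 ^ (a + k))⁻¹) + ε) := by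
  obtain ⟨W, V, hW, hV0, hV1, hWV, hV⟩ := exists_channel_of_isPrivate hprivate hbi
  let S := (Fin n → Z) × (Fin n → E)
  let p : (Fin n → X) → (Fin n → Y) → S → ℝ := fun x y s => iidLaw P x y s.1 s.2
  let Wn : (Fin n → X) × (Fin n → Y) → (Fin n → X) × (Fin n → Y) → ℝ := fun t t' =>
    ∏ i, W (t.1 i, t.2 i) (t'.1 i, t'.2 i)
  let Vn : S → (Fin n → X) × (Fin n → Y) → ℝ := fun s t => ∏ i, V (s.1 i) (t.1 i, t.2 i)
  have hp : ∀ x y s, 0 ≤ p x y s := fun x y s => iidLaw_nonneg hP.1 _ _ _ _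
  have hp1 : ∑ x, ∑ y, ∑ s, p x y s = 1 := by
    simp only [p, S, Fintype.sum_prod_type, sum_iidLaw hP]
  have hsum : ∀ f : Fin n → X × Y → ℝ, ∑ t : (Fin n → X) × (Fin n → Y),
      ∏ i, f i (t.1 i, t.2 i) = ∏ i, ∑ t, f i t := fun f => by
    simp only [Fintype.sum_prod_type]
    simp_rw [fun x : Fin n → X => sum_prod_apply_eq fun i y => f i (x i, y)]
    rw [sum_prod_apply_eq fun i x => ∑ y, f i (x, y)]
  have hWn : ∀ t, Wn t ∈ stdSimplex ℝ ((Fin n → X) × (Fin n → Y)) := fun t =>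
    ⟨fun t' => Finset.prod_nonneg fun i _ => (hW _).1 _, by
      simp only [Wn]
      rw [hsum fun i t' => W (t.1 i, t.2 i) t']
      exact Finset.prod_eq_one fun i _ => (hW _).2⟩
  have hVn1 : ∀ s, ∑ t, Vn s t ≤ 1 := fun s => by
    simp only [Vn]
    rw [hsum fun i t' => V (s.1 i) t']
    exact Finset.prod_le_one (fun i _ => Finset.sum_nonneg fun t _ => hV0 _ t) fun i _ => hV1 _
  have hXS : ∀ x (s : S), ∑ y, p x y s =
      ∏ i, law P (fun w => (w.1, w.2.2)) (x i, s.1 i, s.2 i) := fun x s => sum_iidLaw_Y x s.1 s.2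
  have hS : ∀ s : S, ∑ x, ∑ y, p x y s = ∏ i, law P (fun w => w.2.2) (s.1 i, s.2 i) :=
    fun s => sum_iidLaw_XY s.1 s.2
  obtain ⟨F, G, K, dec, h⟩ := exists_hash (S := S) a k l hp hp1 good hN
    (fun x s => good' x s.1 s.2) hη (fun x s hg => by rw [hXS, hS]; exact hgood' x s.1 s.2 hg) hε0
    (hε.imp id fun hε => by
      refine le_of_eq_of_le ?_ hε
      congr 2
      refine Finset.sum_congr rfl fun x _ => ?_
      rw [Finset.sum_comm]
      simp only [p, S, Fintype.sum_prod_type]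
      refine Finset.sum_congr rfl fun z _ => ?_
      rw [Finset.sum_comm]
      refine Finset.sum_congr rfl fun e _ => ?_
      split_ifs <;> simp)
  refine ⟨hashProtocol F G K dec Wn hWn, ?_⟩
  have herr := hashProtocol_error_le (F := F) (G := G) (K := K) (dec := dec) (W := Wn) (V := Vn)
    hp hp1 (fun x y s t => by
      simp only [p, Wn, Vn, iidLaw, ← Finset.prod_mul_distrib]
      exact Finset.prod_congr rfl fun i _ => hWV _ _ _ _ _)
    (fun s t => Finset.prod_nonneg fun i _ => hV0 _ _) hVn1 (fun s t => by
      rw [hS]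
      simp only [p, Vn, iidLaw, ← Finset.prod_mul_distrib]
      exact Finset.prod_congr rfl fun i _ => hV _ _ (t.1 i, t.2 i)) hWn
  refine le_trans (le_of_eq ?_) (herr.trans (mul_le_mul_of_nonneg_left (h.trans_eq ?_)
    zero_le_two))
  · rfl
  · congr 3
    refine Finset.sum_congr rfl fun x _ => Finset.sum_congr rfl fun y _ => ?_
    split_ifs
    · simp
    · simp only [p, S, Fintype.sum_prod_type]

theorem condEntropy_nonneg {Ω β γ : Type} [Fintype Ω] [Fintype β] [Fintype γ] {p : Ω → ℝ}
    (hp : ∀ w, 0 ≤ p w) (f : Ω → β) (g : Ω → γ) : 0 ≤ condEntropy p f g := by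
  classical
  rw [← neg_nonpos, ← meanLog_condRatio hp]
  refine Finset.sum_nonpos fun w _ => ?_
  by_cases h0 : p w = 0
  · rw [h0, zero_mul]
  refine mul_nonpos_of_nonneg_of_nonpos (hp w)
    (Real.logb_nonpos (by norm_num) (condRatio_pos hp f g h0).le ?_)
  refine div_le_one_of_le₀ ?_ (law_nonneg hp g _)
  refine Finset.sum_le_sum fun w' _ => ?_
  by_cases h : g w' = g w
  · rw [if_pos h]; split_ifs
    · exact le_rfl
    · exact hp w'
  · rw [if_neg h, if_neg fun h' => h (Prod.ext_iff.1 h').2]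

/-- A merging protocol for given numbers of key bits and published bits. -/
theorem exists_mergingProtocol_error_le_of_le (hP : P ∈ stdSimplex ℝ (X × Y × Z × E))
    (hprivate : IsPrivate P) (hbi : IsBiDisjoint (lawTZ P)) {n a k l : ℕ} {τ : ℝ} (hτ : 0 < τ)
    (h₁ : n * condEntropy P (fun w => w.1) (fun w => w.2.1) + 2 * τ ≤ a + k)
    (h₂ : a + l = 0 ∨ a + l ≤ n * condEntropy P (fun w => w.1) (fun w => w.2.2.1) - 2 * τ) :
    ∃ π : MergingProtocol X Y n k l, π.error P ≤
      2 * (2 * (n * varLog P (condRatio P (fun w => w.1) (fun w => w.2.1)) / τ ^ 2 + 2 ^ (-τ)) +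
        (2 * (n * varLog P (condRatio P (fun w => w.1) (fun w => w.2.2)) / τ ^ 2) +
          √(2 ^ (-τ)))) := by
  classical
  rw [condEntropy_eq_of_isPrivate hP hprivate] at h₂
  set H₁ := condEntropy P (fun w => w.1) (fun w => w.2.1) with hH₁
  set H₂ := condEntropy P (fun w => w.1) (fun w => w.2.2) with hH₂
  have m₁ : meanLog P (condRatio P (fun w => w.1) (fun w => w.2.1)) = -H₁ :=
    meanLog_condRatio hP.1 _ _
  have m₂ : meanLog P (condRatio P (fun w => w.1) (fun w => w.2.2)) = -H₂ :=
    meanLog_condRatio hP.1 _ _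
  set r₁ := condRatio P (fun w => w.1) (fun w => w.2.1) with hr₁
  set r₂ := condRatio P (fun w => w.1) (fun w => w.2.2) with hr₂
  have hpos : ∀ {β : Type} [Fintype β] (f : X × Y × Z × E → β) (w : Fin n → X × Y × Z × E),
      ∏ i, P (w i) ≠ 0 → 0 < ∏ i, law P f (f (w i)) := by
    intro β _ f w hw
    have := Finset.prod_ne_zero_iff.1 hw
    exact Finset.prod_pos fun i hi => law_apply_pos hP.1 f (this i hi)
  -- The first clause excludes sequences `y` of probability zero, for which the second would hold
  -- for every `x` and could spoil the count `hN`.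
  let good : (Fin n → X) → (Fin n → Y) → Prop := fun x y =>
    0 < ∏ i, law P (fun w => w.2.1) (y i) ∧
      2 ^ (n * -H₁ - τ) * ∏ i, law P (fun w => w.2.1) (y i) ≤
        ∏ i, law P (fun w => (w.1, w.2.1)) (x i, y i)
  let good' : (Fin n → X) → (Fin n → Z) → (Fin n → E) → Prop := fun x z e =>
    ∏ i, law P (fun w => (w.1, w.2.2)) (x i, z i, e i) ≤
      2 ^ (n * -H₂ + τ) * ∏ i, law P (fun w => w.2.2) (z i, e i)
  have bad₁ := sum_iidLaw_atypical_le (n := n) hP (fun w hw => condRatio_pos hP.1 (fun w => w.1)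
    (fun w => w.2.1) hw) hτ (fun x y _ _ => good x y) (by
    intro x y z e h0 h _
    have hp := hpos (fun w => w.2.1) _ h0
    rw [← hr₁, m₁, hr₁] at h
    simp only [condRatio, Finset.prod_div_distrib] at h
    exact ⟨hp, (le_div_iff₀ hp).1 h⟩)
  have bad₂ := sum_iidLaw_atypical_le (n := n) hP (fun w hw => condRatio_pos hP.1 (fun w => w.1)
    (fun w => w.2.2) hw) hτ (fun x _ z e => good' x z e) (by
    intro x y z e h0 _ h
    have hp := hpos (fun w => w.2.2) _ h0
    rw [← hr₂, m₂, hr₂] at h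
    simp only [condRatio, Finset.prod_div_distrib] at h
    exact (div_le_iff₀ hp).1 h)
  -- Each good `x` has conditional probability at least `2 ^ (-(n H₁ + τ))` given `y`.
  have hN : ∀ y, (∑ x, if good x y then (1 : ℝ) else 0) ≤ 2 ^ (n * H₁ + τ) := by
    intro y
    by_cases hy : 0 < ∏ i, law P (fun w => w.2.1) (y i)
    · have hs : ∑ x : Fin n → X, ∏ i, law P (fun w => (w.1, w.2.1)) (x i, y i) =
          ∏ i, law P (fun w => w.2.1) (y i) := by
        simp_rw [← sum_iidLaw_S, sum_iidLaw_XS]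
      calc (∑ x, if good x y then (1 : ℝ) else 0)
          ≤ ∑ x : Fin n → X, 2 ^ (n * H₁ + τ) / (∏ i, law P (fun w => w.2.1) (y i)) *
              ∏ i, law P (fun w => (w.1, w.2.1)) (x i, y i) := by
            refine Finset.sum_le_sum fun x _ => ?_
            have h0 : 0 ≤ ∏ i, law P (fun w => (w.1, w.2.1)) (x i, y i) :=
              Finset.prod_nonneg fun i _ => law_nonneg hP.1 _ _
            split_ifs with hg
            · have := mul_le_mul_of_nonneg_left hg.2
                (show (0 : ℝ) ≤ 2 ^ (n * H₁ + τ) by positivity)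
              rw [← mul_assoc, ← Real.rpow_add (by norm_num)] at this
              rw [div_mul_eq_mul_div, le_div_iff₀ hy]
              refine le_of_eq_of_le ?_ this
              rw [show n * H₁ + τ + (n * -H₁ - τ) = 0 by ring, Real.rpow_zero]
            · positivity
        _ = _ := by rw [← Finset.mul_sum, hs]; field_simp
    · have : ∀ x, ¬ good x y := fun x hg => hy hg.1
      simp only [this, if_false, Finset.sum_const_zero]
      positivity
  have hVn := fun r => varLog_nonneg hP.1 r
  obtain ⟨π, hπ⟩ := exists_mergingProtocol_error_le hP hprivate hbi n a k l good
    (fun y => by convert hN y) good'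
    (by positivity) (fun x z e hg => hg)
    (ε := 2 * (n * varLog P r₂ / τ ^ 2) + √(2 ^ (-τ)))
    (by have := hVn r₂; positivity) (h₂.imp id fun h₂ => by
      -- Of the slack `2τ` in `h₂`, one `τ` pays for typicality and the other remains as `2 ^ (-τ)`.
      -- The collision term below uses `h₁` in the same way.
      refine add_le_add (mul_le_mul_of_nonneg_left bad₂ zero_le_two) (Real.sqrt_le_sqrt ?_)
      rw [← Real.rpow_natCast, ← Real.rpow_add (by norm_num)]
      refine Real.rpow_le_rpow_of_exponent_le (by norm_num) ?_
      push_cast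
      linarith)
  refine ⟨π, hπ.trans (mul_le_mul_of_nonneg_left (add_le_add_left
    (mul_le_mul_of_nonneg_left (add_le_add bad₁ ?_) zero_le_two) _) zero_le_two)⟩
  rw [← Real.rpow_natCast, ← Real.rpow_neg (by norm_num), ← Real.rpow_add (by norm_num)]
  refine Real.rpow_le_rpow_of_exponent_le (by norm_num) ?_
  push_cast
  linarith

/-- The number of bits that Alice publishes can be chosen to suit a given balance of key bits. -/
theorem exists_publish_length {H₁ H₂ τ : ℝ} (hH₁ : 0 ≤ H₁) (hτ : 0 ≤ τ) {n k l : ℕ}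
    (hkl : k = 0 ∨ l = 0) (h : n * (H₁ - H₂) + 4 * τ + 1 ≤ (k : ℝ) - l) :
    ∃ a : ℕ, n * H₁ + 2 * τ ≤ a + k ∧ (a + l = 0 ∨ a + l ≤ n * H₂ - 2 * τ) := by
  rcases hkl with rfl | rfl
  · have h0 : 0 ≤ n * H₁ + 2 * τ := by positivity
    -- Without initial key the bits published in clear must suffice for decoding, so `a` is the
    -- least possible; the `+ 1` in `h` pays for rounding.
    refine ⟨⌈n * H₁ + 2 * τ⌉₊, by simpa using Nat.le_ceil _, Or.inr ?_⟩
    have := Nat.ceil_lt_add_one h0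
    push_cast at h
    linarith
  · push_cast at h
    -- Without final key Alice publishes in clear as much as stays independent of the passive
    -- parties. If that is negative, the floor gives `a = 0` and the padded bits alone suffice.
    refine ⟨⌊n * H₂ - 2 * τ⌋₊, ?_, ?_⟩
    · have := Nat.lt_floor_add_one (n * H₂ - 2 * τ)
      linarith
    · rcases le_or_gt 0 (n * H₂ - 2 * τ) with h0 | h0
      · right
        simpa using Nat.floor_le h0
      · left
        simpa using Nat.floor_of_nonpos h0.le

/-- With `τ = n ^ (3/4)` the variance terms are of order `n ^ (-1/2)`, while `τ / n` still vanishes.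
Any exponent strictly between `1/2` and `1` would serve. -/
theorem tendsto_error_bound (V₁ V₂ : ℝ) :
    Tendsto (fun n : ℕ => 2 * (2 * (n * V₁ / ((n : ℝ) ^ (3 / 4 : ℝ)) ^ 2 +
        (2 : ℝ) ^ (-(n : ℝ) ^ (3 / 4 : ℝ))) +
      (2 * (n * V₂ / ((n : ℝ) ^ (3 / 4 : ℝ)) ^ 2) + √(2 ^ (-(n : ℝ) ^ (3 / 4 : ℝ))))))
      atTop (𝓝 0) := by
  have hτ : Tendsto (fun n : ℕ => (n : ℝ) ^ (3 / 4 : ℝ)) atTop atTop :=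
    (tendsto_rpow_atTop (by norm_num)).comp tendsto_natCast_atTop_atTop
  have h1 : ∀ V : ℝ, Tendsto (fun n : ℕ => n * V / ((n : ℝ) ^ (3 / 4 : ℝ)) ^ 2) atTop (𝓝 0) := by
    intro V
    have h0 : Tendsto (fun n : ℕ => V * (n : ℝ) ^ (-(1 / 2) : ℝ)) atTop (𝓝 (V * 0)) :=
      ((tendsto_rpow_neg_atTop (by norm_num)).comp tendsto_natCast_atTop_atTop).const_mul V
    rw [mul_zero] at h0
    refine h0.congr' ?_
    filter_upwards [eventually_gt_atTop 0] with n hn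
    have hn' : (0 : ℝ) < n := by exact_mod_cast hn
    rw [← Real.rpow_natCast, ← Real.rpow_mul hn'.le, eq_div_iff (by positivity), mul_assoc,
      ← Real.rpow_add hn']
    norm_num
    ring
  have h2 : Tendsto (fun n : ℕ => (2 : ℝ) ^ (-(n : ℝ) ^ (3 / 4 : ℝ))) atTop (𝓝 0) :=
    (tendsto_rpow_atBot_of_base_gt_one 2 (by norm_num)).comp
      (tendsto_neg_atTop_atBot.comp hτ)
  have h3 := h2.sqrt
  rw [Real.sqrt_zero] at h3
  simpa using ((((h1 V₁).add h2).const_mul 2).add (((h1 V₂).const_mul 2).add h3)).const_mul 2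

theorem l1Dist_nonneg {α : Type} [Fintype α] (p q : α → ℝ) : 0 ≤ l1Dist p q :=
  Finset.sum_nonneg fun _ _ => abs_nonneg _

/-- Merging is possible whenever the net key consumption exceeds the optimal rate by a margin
of order `n ^ (3 / 4)`. -/
theorem exists_mergingScheme (hP : P ∈ stdSimplex ℝ (X × Y × Z × E))
    (hprivate : IsPrivate P) (hbi : IsBiDisjoint (lawTZ P)) (k l : ℕ → ℕ)
    (hkl : ∀ᶠ n : ℕ in atTop, (k n = 0 ∨ l n = 0) ∧
      n * (infoXZ P - infoXY P) + 4 * (n : ℝ) ^ (3 / 4 : ℝ) + 1 ≤ (k n : ℝ) - l n) :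
    ∃ S : MergingScheme P, S.k = k ∧ S.l = l := by
  classical
  have hex : ∀ n : ℕ, ∃ π : MergingProtocol X Y n (k n) (l n),
      (0 < n ∧ (k n = 0 ∨ l n = 0) ∧
        n * (infoXZ P - infoXY P) + 4 * (n : ℝ) ^ (3 / 4 : ℝ) + 1 ≤ (k n : ℝ) - l n) →
      π.error P ≤ 2 * (2 * (n * varLog P (condRatio P (fun w => w.1) (fun w => w.2.1)) /
          ((n : ℝ) ^ (3 / 4 : ℝ)) ^ 2 + 2 ^ (-(n : ℝ) ^ (3 / 4 : ℝ))) +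
        (2 * (n * varLog P (condRatio P (fun w => w.1) (fun w => w.2.2)) /
          ((n : ℝ) ^ (3 / 4 : ℝ)) ^ 2) + √(2 ^ (-(n : ℝ) ^ (3 / 4 : ℝ))))) := by
    intro n
    by_cases hc : 0 < n ∧ (k n = 0 ∨ l n = 0) ∧
        n * (infoXZ P - infoXY P) + 4 * (n : ℝ) ^ (3 / 4 : ℝ) + 1 ≤ (k n : ℝ) - l n
    · obtain ⟨hn, h1, h2⟩ := hc
      have hτ : (0 : ℝ) < (n : ℝ) ^ (3 / 4 : ℝ) := Real.rpow_pos_of_pos (by exact_mod_cast hn) _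
      rw [infoXZ_sub_infoXY] at h2
      obtain ⟨a, ha₁, ha₂⟩ := exists_publish_length
        (condEntropy_nonneg hP.1 (fun w => w.1) (fun w => w.2.1)) hτ.le h1 h2
      obtain ⟨π, hπ⟩ := exists_mergingProtocol_error_le_of_le hP hprivate hbi hτ ha₁ ha₂
      exact ⟨π, fun _ => hπ⟩
    -- For the finitely many remaining `n` any protocol will do. Empty good sets give one, with `max
    -- 0 _` as `ε`.
    · obtain ⟨π, -⟩ := exists_mergingProtocol_error_le hP hprivate hbi n 0 (k n) (l n)
        (fun _ _ => False) (N := 0) (by simp) (fun _ _ _ => False) (η := 0) le_rfl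
        (fun _ _ _ h => h.elim) (le_max_left 0 _)
        (Or.inr (le_max_right 0 _))
      exact ⟨π, fun h => (hc h).elim⟩
  choose π hπ using hex
  refine ⟨⟨k, l, π, ?_⟩, rfl, rfl⟩
  refine tendsto_of_tendsto_of_tendsto_of_le_of_le' tendsto_const_nhds
    (tendsto_error_bound (varLog P (condRatio P (fun w => w.1) (fun w => w.2.1)))
      (varLog P (condRatio P (fun w => w.1) (fun w => w.2.2))))
    (Eventually.of_forall fun n => l1Dist_nonneg _ _) ?_
  filter_upwards [hkl, eventually_gt_atTop 0] with n h1 h2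
  exact hπ n ⟨h2, h1⟩

/-- The net number of key bits that the protocol for rate `R` consumes. -/
noncomputable def keyBalance (R : ℝ) (n : ℕ) : ℤ := ⌈n * R + 4 * (n : ℝ) ^ (3 / 4 : ℝ) + 1⌉

theorem tendsto_keyBalance_div (R : ℝ) :
    Tendsto (fun n : ℕ => (keyBalance R n : ℝ) / n) atTop (𝓝 R) := by
  have h0 : Tendsto (fun n : ℕ => 4 * (n : ℝ) ^ (-(1 / 4) : ℝ)) atTop (𝓝 (4 * 0)) :=
    ((tendsto_rpow_neg_atTop (by norm_num)).comp tendsto_natCast_atTop_atTop).const_mul 4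
  have h1 : ∀ c : ℝ, Tendsto (fun n : ℕ => R + 4 * (n : ℝ) ^ (-(1 / 4) : ℝ) + c / n) atTop
      (𝓝 R) := fun c => by
    simpa using (h0.const_add R).add (tendsto_const_div_atTop_nhds_zero_nat c)
  have h2 : ∀ (c : ℝ) {n : ℕ}, 0 < n →
      R + 4 * (n : ℝ) ^ (-(1 / 4) : ℝ) + c / n = (n * R + 4 * (n : ℝ) ^ (3 / 4 : ℝ) + c) / n := by
    intro c n hn
    have hn' : (0 : ℝ) < n := by exact_mod_cast hn
    have : (n : ℝ) ^ (3 / 4 : ℝ) = (n : ℝ) ^ (-(1 / 4) : ℝ) * n := by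
      rw [← Real.rpow_add_one hn'.ne']; norm_num
    rw [this]
    field_simp
  refine tendsto_of_tendsto_of_tendsto_of_le_of_le' (h1 1) (h1 2) ?_ ?_
  · filter_upwards [eventually_gt_atTop 0] with n hn
    rw [h2 1 hn]
    exact div_le_div_of_nonneg_right (Int.le_ceil _) (Nat.cast_nonneg n)
  · filter_upwards [eventually_gt_atTop 0] with n hn
    rw [h2 2 hn]
    refine div_le_div_of_nonneg_right ?_ (Nat.cast_nonneg n)
    have := Int.ceil_lt_add_one (n * R + 4 * (n : ℝ) ^ (3 / 4 : ℝ) + 1)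
    unfold keyBalance
    linarith

theorem toNat_sub_toNat_neg_cast (m : ℤ) : (m.toNat : ℝ) - ((-m).toNat : ℝ) = m := by
  exact_mod_cast Int.toNat_sub_toNat_neg m

/-- Every rate that is at least optimal is achieved. -/
theorem exists_mergingScheme_keyBalance (hP : P ∈ stdSimplex ℝ (X × Y × Z × E))
    (hprivate : IsPrivate P) (hbi : IsBiDisjoint (lawTZ P)) {R : ℝ}
    (hR : infoXZ P - infoXY P ≤ R) :
    ∃ S : MergingScheme P, (S.k = fun n => (keyBalance R n).toNat) ∧
      S.l = fun n => (-keyBalance R n).toNat := by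
  refine exists_mergingScheme hP hprivate hbi _ _ (Eventually.of_forall fun n => ⟨by omega, ?_⟩)
  rw [toNat_sub_toNat_neg_cast]
  have := mul_le_mul_of_nonneg_left hR (Nat.cast_nonneg (α := ℝ) n)
  exact le_trans (by linarith) (Int.le_ceil _)

end Direct

/-! ### The merging theorem -/

theorem theorem1 {X Y Z E : Type} [Fintype X] [Fintype Y] [Fintype Z] [Fintype E]
    (P : X × Y × Z × E → ℝ) (hP : P ∈ stdSimplex ℝ (X × Y × Z × E))
    (hprivate : IsPrivate P) (hbidisjoint : IsBiDisjoint (lawTZ P)) :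
    infoXZ P - infoXY P =
        condEntropy P (fun w => w.1) (fun w => w.2.1) -
          condEntropy P (fun w => w.1) (fun w => w.2.2.1) ∧
    (∀ S : MergingScheme P, ∀ δ : ℝ, 0 < δ →
        ∀ᶠ n : ℕ in atTop, infoXZ P - infoXY P - δ ≤ S.rate n) ∧
    (∀ R : ℝ, infoXZ P - infoXY P ≤ R →
        ∃ S : MergingScheme P, Tendsto S.rate atTop (𝓝 R)) ∧
    (0 ≤ infoXZ P - infoXY P →
        ∃ S : MergingScheme P, (∀ n, S.l n = 0) ∧
          Tendsto (fun n : ℕ => (S.k n : ℝ) / n) atTop (𝓝 (infoXZ P - infoXY P))) ∧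
    (infoXZ P - infoXY P < 0 →
        ∃ S : MergingScheme P, (∀ n, S.k n = 0) ∧
          Tendsto (fun n : ℕ => (S.l n : ℝ) / n) atTop (𝓝 (infoXY P - infoXZ P))) := by
  refine ⟨infoXZ_sub_infoXY P, fun S δ hδ => S.eventually_le_rate hP hprivate hδ, ?_, ?_, ?_⟩
  · intro R hR
    obtain ⟨S, hk, hl⟩ := exists_mergingScheme_keyBalance hP hprivate hbidisjoint hR
    refine ⟨S, (tendsto_keyBalance_div R).congr fun n => ?_⟩
    rw [MergingScheme.rate, hk, hl, toNat_sub_toNat_neg_cast]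
  · intro h0
    obtain ⟨S, hk, hl⟩ := exists_mergingScheme_keyBalance hP hprivate hbidisjoint le_rfl
    have hpos : ∀ n, 0 ≤ keyBalance (infoXZ P - infoXY P) n := fun n =>
      Int.ceil_nonneg (by positivity)
    refine ⟨S, fun n => ?_, (tendsto_keyBalance_div _).congr fun n => ?_⟩
    · rw [hl]; exact Int.toNat_of_nonpos (neg_nonpos.2 (hpos n))
    · rw [hk]
      congr 1
      exact_mod_cast (Int.toNat_of_nonneg (hpos n)).symm
  · intro h0
    have hlim := tendsto_keyBalance_div (infoXZ P - infoXY P)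
    -- For small `n` the sublinear margin can make the balance nonnegative. There `toNat` truncates
    -- `l` to zero, which is harmless because `exists_mergingScheme` needs its bound only
    -- eventually.
    have hneg : ∀ᶠ n : ℕ in atTop, keyBalance (infoXZ P - infoXY P) n < 0 := by
      filter_upwards [hlim.eventually (gt_mem_nhds h0)] with n hn
      by_contra! h
      exact absurd hn (not_lt.2 (div_nonneg (by exact_mod_cast h) (Nat.cast_nonneg n)))
    have hcast : ∀ᶠ n : ℕ in atTop, ((-keyBalance (infoXZ P - infoXY P) n).toNat : ℝ) =
        -keyBalance (infoXZ P - infoXY P) n := by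
      filter_upwards [hneg] with n hn
      exact_mod_cast Int.toNat_of_nonneg (by omega : 0 ≤ -keyBalance (infoXZ P - infoXY P) n)
    obtain ⟨S, hk, hl⟩ := exists_mergingScheme hP hprivate hbidisjoint (fun _ => 0)
      (fun n => (-keyBalance (infoXZ P - infoXY P) n).toNat) (by
        filter_upwards [hcast] with n hn
        refine ⟨Or.inl rfl, ?_⟩
        rw [hn]
        rw [Nat.cast_zero, zero_sub, neg_neg]
        exact Int.le_ceil _)
    refine ⟨S, fun n => by rw [hk], ?_⟩
    rw [hl]
    have := hlim.neg
    rw [neg_sub] at this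
    refine this.congr' ?_
    filter_upwards [hcast] with n hn
    rw [hn, neg_div]
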